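/- We consider one mobile agent in a finite simple connected undirected graph $G$. The nodes have no labels, but a node of degree $d$ has ports $1,\dots,d$ corresponding to its incident edges. An initial configuration $(G,\{s\},i,w)$ consists of such a graph $G$, the starting node $s$, the agent's identity $i\in\{1,2,\dots\}$ and its input $w\in\{0,1\}^*$. The agent runs a deterministic algorithm with unlimited memory. At the start it knows only $i$, $w$ (and a certificate, if there is one) and the degree of $s$. In each round it stays, or leaves through a port of its choice, in which case it then perceives the entry port and the degree of the node it reaches; or it ends with the decision "yes" or "no". A decision problem (for a single agent) is a set $\Pi$ of initial configurations, invariant under port-preserving isomorphism, for which some algorithm decides, given the description of any configuration, whether it lies in $\Pi$. The class $\mathrm{MAV}_1$ consists of the decision problems $\Pi$ for which there is a protocol that, for every initial configuration $(G,\{s\},i,w)$ and every certificate $x\in\{0,1\}^*$, eventually decides, and is such that: if $(G,\{s\},i,w)\in\Pi$, then for some certificate $x$ the agent decides "yes"; if $(G,\{s\},i,w)\notin\Pi$, then for every certificate $x$ the agent decides "no". A problem $\Pi$ is reducible to a problem $\Pi'$ if there is a protocol that decides $\Pi$ (on every initial configuration $(G,\{s\},i,w)$ it ends with the decision "yes"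 if the configuration is in $\Pi$ and "no" otherwise) and that may call, finitely many times during an execution, a black box which for a string $q\in\{0,1\}^*$ tells whether $(G,\{s\},i,q)\in\Pi'$. A problem is $\mathrm{MAV}_1$-complete if it belongs to $\mathrm{MAV}_1$ and every problem in $\mathrm{MAV}_1$ is reducible to it. The truncated view of depth $0$ from a node $v$ is a single node; the truncated view of depth $t+1$ from $v$ is the rooted tree with port numbers whose root has one child for each neighbour $u$ of $v$, joined by an edge with the same port numbers as $\{v,u\}$, at which the truncated view of depth $t$ from $u$ is rooted. Two nodes have the same view if their truncated views of every depth are isomorphic. The quotient graph $\widehat G$ has as nodes the classes of nodes of $G$ with the same view; there is an edge between the (possibly equal) classes $U$ and $V$ with label $p$ at $U$ and $q$ at $V$ if and only if $G$ has an edge $\{u,v\}$, $u\in U$, $v\in V$, with port $p$ at $u$ and port $q$ at $v$. (So $\widehat G$ may have self-loops and multiple edges.) **Statement.** The decision problem $$\mathtt{quotient}=\{(G,\{s\},i,H):\ \widehat G\not\cong H\},$$ where the input $H$ is (a fixed standard binary description of) a finite connected, not necessarily simple, graph with positive integer port labels, and $\cong$ is isomorphism preserving edges and port labels, is $\mathrm{MAV}_1$-complete.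 -/

import Mathlib

namespace MobileAgents

/-! ### Graphs with port numbers -/

/-- A finite simple connected (in particular non-empty) graph with port numbers.  Nodes carry the
auxiliary names `0, …, size - 1`, which no agent ever sees.  For adjacent `u` and `v`, `port u v`
is the port number at `u` of the edge `{u, v}`; the ports at a node of degree `d` are `1, …, d`.
For non-adjacent nodes `port u v = 0`. -/
structure PortGraph where
  size : ℕ
  graph : SimpleGraph (Fin size)
  connected : graph.Connected
  port : Fin size → Fin size → ℕ
  port_bijOn : ∀ u, Set.BijOn (port u) (graph.neighborSet u)
    (Set.Icc 1 (graph.neighborSet u).ncard)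
  port_eq_zero : ∀ u v, ¬ graph.Adj u v → port u v = 0

namespace PortGraph

variable (G : PortGraph)

/-- The degree of a node. -/
noncomputable def degree (u : Fin G.size) : ℕ := (G.graph.neighborSet u).ncard

/-- The node reached from `u` through port `p`, if there is a port `p` at `u`. -/
def follow (u : Fin G.size) (p : ℕ) : Option (Fin G.size) :=
  (List.finRange G.size).find? fun v => p ≠ 0 ∧ G.port u v = p

/-- Bijections between the nodes that preserve adjacency and port numbers (recall that
`port u v = 0` exactly when `u` and `v` are not adjacent). -/
structure Iso (G G' : PortGraph) where
  toEquiv : Fin G.size ≃ Fin G'.size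
  port_eq : ∀ u v, G'.port (toEquiv u) (toEquiv v) = G.port u v

end PortGraph

/-! ### Views and the quotient graph -/

/-- Rooted trees with port numbers.  `child p = some (q, T)` means that the edge with port `p` at
the root leads to a child at which this edge has port `q` and below which the subtree `T` hangs;
`child p = none` means that there is no port `p` at the root that leads to a child.  Two such trees
are isomorphic (as rooted trees with port numbers) exactly when they are equal. -/
inductive ViewTree : Type
  | node (child : ℕ → Option (ℕ × ViewTree)) : ViewTree

namespace PortGraph

variable (G : PortGraph)

/-- The view from `u` truncated at depth `t`. -/
def view : ℕ → Fin G.size → ViewTree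
  | 0, _ => .node fun _ => none
  | t + 1, u => .node fun p => (G.follow u p).map fun v => (G.port v u, view t v)

/-- Two nodes are equivalent when they have the same (infinite) view, that is, when their
truncated views agree at every depth. -/
def viewSetoid : Setoid (Fin G.size) where
  r u v := ∀ t, G.view t u = G.view t v
  iseqv := ⟨fun _ _ => rfl, fun h t => (h t).symm, fun h k t => (h t).trans (k t)⟩

end PortGraph

/-- A not necessarily simple graph with port labels on the node set `V`.  The edge
`s((x, p), (y, q))` joins `x` and `y` and has label `p` at `x` and `q` at `y`.  Self-loops (`x = y`,
possibly with `p = q`) and several edges between the same two nodes are allowed. -/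
structure PortMultigraph (V : Type) where
  edges : Set (Sym2 (V × ℕ))

namespace PortMultigraph

/-- Connectedness; it includes that there is at least one node. -/
def Connected {V : Type} (H : PortMultigraph V) : Prop :=
  (SimpleGraph.fromRel fun x y : V => ∃ p q, s((x, p), (y, q)) ∈ H.edges).Connected

/-- The two graphs are equal as graphs without node names: some bijection between the nodes
carries the labelled edges of one onto those of the other. -/
def IsIsomorphic {V W : Type} (H : PortMultigraph V) (K : PortMultigraph W) : Prop :=
  ∃ φ : V ≃ W, Sym2.map (Prod.map φ id) '' H.edges = K.edges

end PortMultigraph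

/-- The quotient graph: its nodes are the classes of nodes with the same view, and every edge
`{u, v}` of `G` induces an edge between the classes of `u` and `v`, with the same port labels. -/
def PortGraph.quotient (G : PortGraph) : PortMultigraph (Quotient G.viewSetoid) where
  edges := {e | ∃ u v, G.graph.Adj u v ∧
    e = s((Quotient.mk G.viewSetoid u, G.port u v), (Quotient.mk G.viewSetoid v, G.port v u))}

/-- The port-labelled graph on `0, …, n - 1` with a given list of edges: the entry
`((x, p), (y, q))` stands for an edge between `x` and `y` with label `p` at `x` and `q` at `y`. -/
def PortMultigraph.ofList {n : ℕ} (L : List ((Fin n × ℕ) × (Fin n × ℕ))) :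
    PortMultigraph (Fin n) where
  edges := {e | ∃ d ∈ L, e = s(d.1, d.2)}

/-- A finite connected port-labelled graph, not necessarily simple, with positive labels,
presented by its number of nodes and a list of its edges. -/
structure GivenGraph where
  size : ℕ
  edgeList : List ((Fin size × ℕ) × (Fin size × ℕ))
  label_pos : ∀ d ∈ edgeList, 0 < d.1.2 ∧ 0 < d.2.2
  connected : (PortMultigraph.ofList edgeList).Connected

/-- The graph that is presented. -/
def GivenGraph.toMultigraph (H : GivenGraph) : PortMultigraph (Fin H.size) :=
  PortMultigraph.ofList H.edgeList

/-- The binary string that describes the graph: the binary digits of the natural number that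
encodes the number of nodes together with the list of edges. -/
def GivenGraph.code (H : GivenGraph) : List Bool :=
  Nat.bits (Encodable.encode ((H.size, H.edgeList.map fun d =>
    ((d.1.1.val, d.1.2), (d.2.1.val, d.2.2))) : ℕ × List ((ℕ × ℕ) × (ℕ × ℕ))))

/-! ### Initial configurations and decision problems for a single agent -/

/-- An initial configuration `(G, {s}, i, w)` with a single agent, which starts at the node `s`,
has the positive identity `i` and the input string `w`. -/
structure Config where
  G : PortGraph
  start : Fin G.size
  ident : ℕ
  ident_pos : 0 < ident
  input : List Bool

/-- The description of a configuration that is given to an algorithm: the matrix of the port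
numbers (which also shows the adjacencies), the start, the identity and the input. -/
def Config.code (c : Config) : List (List ℕ) × ℕ × ℕ × List Bool :=
  (List.ofFn fun u => List.ofFn fun v => c.G.port u v, c.start.val, c.ident, c.input)

/-- The two configurations differ only by the names of the nodes. -/
def Config.IsIsomorphic (c c' : Config) : Prop :=
  ∃ φ : PortGraph.Iso c.G c'.G,
    φ.toEquiv c.start = c'.start ∧ c'.ident = c.ident ∧ c'.input = c.input

/-- The class `Δ₁` of decision problems for a single agent: the sets of configurations that are
decidable by an algorithm which is given the whole configuration, and that do not depend on the
names of the nodes. -/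
def Delta1 : Set (Set Config) :=
  {Pb | (∃ f : List (List ℕ) × ℕ × ℕ × List Bool → Bool,
      Computable f ∧ ∀ c : Config, f c.code = true ↔ c ∈ Pb) ∧
    ∀ c c' : Config, c.IsIsomorphic c' → (c ∈ Pb ↔ c' ∈ Pb)}

/-- The problem `quotient`: the input is the description of a graph `H`, and the quotient of the
graph in which the agent operates is different from `H`. -/
def quotientProblem : Set Config :=
  {c | ∃ H : GivenGraph, c.input = H.code ∧ ¬ c.G.quotient.IsIsomorphic H.toMultigraph}

/-! ### Protocols -/

/-- What an agent can do in one round: stay, leave through a port, call a black box with a query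
from `Q`, or make its final decision (`true` is "yes", `false` is "no"). -/
inductive Action (Q : Type) : Type
  | stay : Action Q
  | move (p : ℕ) : Action Q
  | query (q : Q) : Action Q
  | answer (b : Bool) : Action Q

/-- Actions as a sum type; it transports computability to actions. -/
def Action.equivSum (Q : Type) : Action Q ≃ Option ℕ ⊕ (Q ⊕ Bool) where
  toFun
    | .stay => .inl none
    | .move p => .inl (some p)
    | .query q => .inr (.inl q)
    | .answer b => .inr (.inr b)
  invFun
    | .inl none => .stay
    | .inl (some p) => .move p
    | .inr (.inl q) => .query q
    | .inr (.inr b) => .answer b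
  left_inv a := by cases a <;> rfl
  right_inv a := by rcases a with (_ | _) | _ | _ <;> rfl

instance (Q : Type) [Primcodable Q] : Primcodable (Action Q) :=
  Primcodable.ofEquiv (Option ℕ ⊕ (Q ⊕ Bool)) (Action.equivSum Q)

/-- What an agent perceives: the port through which it has just entered the current node (`none`
if it has not moved in the last round), the degree of the current node, and the answer of the black
box (`none` if there was no call in the last round). -/
abbrev Percept : Type := Option ℕ × ℕ × Option Bool

/-- A deterministic protocol for a single agent: a state machine with unlimited memory that is run
by an algorithm.  `I` is the type of the data that the agent is given at the start, `Q` the type of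
the queries to a black box (`Empty` if there is none). -/
structure Protocol (I Q : Type) [Primcodable I] [Primcodable Q] where
  Mem : Type
  primcodableMem : Primcodable Mem
  init : I → Mem
  step : Mem → Percept → Mem × Action Q
  computable_init : Computable init
  computable_step : Computable₂ step

/-- The situation between two rounds: the agent is still running, at some node, with some memory
content and its latest perception, or it has decided. -/
inductive Status (V M : Type) : Type
  | running (v : V) (m : M) (o : Percept) : Status V M
  | decided (b : Bool) : Status V M

namespace Protocol

variable {I Q : Type} [Primcodable I] [Primcodable Q]

open Classical in
/-- One round in `G`, where `O` is the set of queries to which the black box answers "yes".  An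
agent that names a port which does not exist at its node stays there. -/
noncomputable def next (P : Protocol I Q) (G : PortGraph) (O : Set Q) :
    Status (Fin G.size) P.Mem → Status (Fin G.size) P.Mem
  | .decided b => .decided b
  | .running v m o =>
    match P.step m o with
    | (m', .stay) => .running v m' (none, G.degree v, none)
    | (m', .move p) =>
      match G.follow v p with
      | some u => .running u m' (some (G.port u v), G.degree u, none)
      | none => .running v m' (none, G.degree v, none)
    | (m', .query q) => .running v m' (none, G.degree v, some (decide (q ∈ O)))
    | (_, .answer b) => .decided b

/-- Started at `s` with the data `a`, the agent eventually makes the decision `b`. -/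
def Decides (P : Protocol I Q) (G : PortGraph) (O : Set Q) (s : Fin G.size) (a : I) (b : Bool) :
    Prop :=
  ∃ t : ℕ, (P.next G O)^[t] (.running s (P.init a) (none, G.degree s, none)) = .decided b

end Protocol

/-! ### Verifiability, reducibility, completeness -/

/-- The verification property.  The agent knows its identity, its input and the certificate `x`;
it has no black box. -/
def Verifies (P : Protocol (ℕ × List Bool × List Bool) Empty) (Pb : Set Config) : Prop :=
  ∀ c : Config,
    (∀ x, ∃ b, P.Decides c.G ∅ c.start (c.ident, c.input, x) b) ∧
    (c ∈ Pb → ∃ x, P.Decides c.G ∅ c.start (c.ident, c.input, x) true) ∧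
    (c ∉ Pb → ∀ x, P.Decides c.G ∅ c.start (c.ident, c.input, x) false)

/-- The class `MAV₁` of mobile agents verifiable problems for a single agent. -/
def MAV1 : Set (Set Config) :=
  {Pb | Pb ∈ Delta1 ∧ ∃ P : Protocol (ℕ × List Bool × List Bool) Empty, Verifies P Pb}

/-- `Pb` is reducible to `Pb'`: some protocol decides `Pb` with a black box for `Pb'`.  Called with
the string `q`, the black box tells whether the initial configuration with its input replaced by
`q` belongs to `Pb'`. -/
def Reducible (Pb Pb' : Set Config) : Prop :=
  ∃ P : Protocol (ℕ × List Bool) (List Bool), ∀ c : Config,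
    (c ∈ Pb → P.Decides c.G {q | { c with input := q } ∈ Pb'} c.start (c.ident, c.input) true) ∧
    (c ∉ Pb → P.Decides c.G {q | { c with input := q } ∈ Pb'} c.start (c.ident, c.input) false)

/-- `Pb` is complete for the class `C`. -/
def IsComplete (C : Set (Set Config)) (Pb : Set Config) : Prop :=
  Pb ∈ C ∧ ∀ Pb' ∈ C, Reducible Pb' Pb

end MobileAgents

/-! The view from the start determines all that an agent can perceive. Two nodes have the same view
exactly when no sequence of ports yields different entry ports from them (`Indist`,
`PortGraph.viewSetoid_iff`), and runs from indistinguishable starts agree round by round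
(`Protocol.Decides.of_indist`). By connectedness, the view from one node also determines the
quotient graph: `isIsomorphic_iff` says that it is `H` exactly if no port of `H` is ambiguous,
distinct nodes of `H` are distinguishable, and some node of `H` is indistinguishable from the start.

Membership: each of the three conditions, when it fails, fails for a finite reason. An ambiguous
port is visible in `H`. A coloring that is a bisimulation shows that two nodes of `H` are
indistinguishable. If the start differs from every node of `H`, a single walk separates it from all
of them at once (`exists_separating_walk`, which needs that steps can be undone). The certificate
encodes a walk and a coloring; the agent makes the walk and compares its history with those computed
in `H` (`not_refutes`, `exists_refutes`). When `G` is given, being the quotient graph has finite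
evidence as well (`Confirms`), so a search for evidence of either kind decides the problem.

Hardness: for the code of a graph `H` the black box says "no" exactly if `H` is the quotient graph
of `G`. The agent enumerates guesses consisting of a graph `G'`, its quotient `H`, a walk that
separates the nodes of `H`, and colorings that prove these claims, until the black box says "no".
Then `G` and `G'` have the same quotient, and the history of that walk, made in `G`, singles out
nodes of `G'` with the same view as the start (`locate_spec`). A verifiable problem cannot tell such
starts apart, because a certificate accepted at one is accepted at the other (`mem_of_indist`). So
the agent may apply the decision algorithm of the problem to the guessed configuration. -/

namespace MobileAgents

/-! ### Walks and the histories that they produce -/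

/-- Follow the ports in `σ`, starting in the state `s.1` and adding to the history `s.2` (latest
entry first). -/
def walk {V : Type} (δ : V → ℕ → V × Option ℕ) (σ : List ℕ) (s : V × List (Option ℕ)) :
    V × List (Option ℕ) :=
  σ.foldl (fun s p => ((δ s.1 p).1, (δ s.1 p).2 :: s.2)) s

/-- The entry ports perceived along a walk, latest first. -/
def history {V : Type} (δ : V → ℕ → V × Option ℕ) (v : V) (σ : List ℕ) : List (Option ℕ) :=
  (walk δ σ (v, [])).2

/-- No walk distinguishes the two states. -/
def Indist {V W : Type} (δ : V → ℕ → V × Option ℕ) (ε : W → ℕ → W × Option ℕ) (v : V) (w : W) :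
    Prop :=
  ∀ σ, history δ v σ = history ε w σ

/-- Every step can be undone through the entry port; a step without an entry port goes nowhere. -/
structure Reversible {V : Type} (δ : V → ℕ → V × Option ℕ) : Prop where
  back : ∀ v p q, (δ v p).2 = some q → δ (δ v p).1 q = (v, some p)
  stay : ∀ v p, (δ v p).2 = none → (δ v p).1 = v

section Walk

variable {V W X : Type} {δ : V → ℕ → V × Option ℕ} {ε : W → ℕ → W × Option ℕ}
  {ζ : X → ℕ → X × Option ℕ}

theorem walk_cons (p : ℕ) (σ : List ℕ) (s : V × List (Option ℕ)) :
    walk δ (p :: σ) s = walk δ σ ((δ s.1 p).1, (δ s.1 p).2 :: s.2) := rfl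

theorem walk_append (σ τ : List ℕ) (s : V × List (Option ℕ)) :
    walk δ (σ ++ τ) s = walk δ τ (walk δ σ s) := by
  simp [walk, List.foldl_append]

theorem walk_eq (σ : List ℕ) (v : V) (h : List (Option ℕ)) :
    walk δ σ (v, h) = ((walk δ σ (v, [])).1, history δ v σ ++ h) := by
  induction σ generalizing v h with
  | nil => rfl
  | cons p σ ih =>
    simp only [history, walk_cons] at ih ⊢
    rw [ih, ih (δ v p).1 [(δ v p).2]]
    simp

theorem history_nil (v : V) : history δ v [] = [] := rfl

theorem history_cons (v : V) (p : ℕ) (σ : List ℕ) :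
    history δ v (p :: σ) = history δ (δ v p).1 σ ++ [(δ v p).2] := by
  simp only [history, walk_cons]
  rw [walk_eq]
  rfl

theorem history_append (v : V) (σ τ : List ℕ) :
    history δ v (σ ++ τ) = history δ (walk δ σ (v, [])).1 τ ++ history δ v σ := by
  conv_lhs => rw [history, walk_append, ← Prod.mk.eta (p := walk δ σ (v, [])), walk_eq]
  rfl

theorem length_history (v : V) (σ : List ℕ) : (history δ v σ).length = σ.length := by
  induction σ generalizing v with
  | nil => rfl
  | cons p σ ih => simp [history_cons, ih]

theorem Indist.refl (v : V) : Indist δ δ v v := fun _ => rfl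

theorem Indist.symm {v : V} {w : W} (h : Indist δ ε v w) : Indist ε δ w v := fun σ => (h σ).symm

theorem Indist.trans {v : V} {w : W} {x : X} (h : Indist δ ε v w) (k : Indist ε ζ w x) :
    Indist δ ζ v x := fun σ => (h σ).trans (k σ)

theorem Indist.entry_eq {v : V} {w : W} (h : Indist δ ε v w) (p : ℕ) : (δ v p).2 = (ε w p).2 := by
  simpa [history_cons, history_nil] using h [p]

theorem Indist.next {v : V} {w : W} (h : Indist δ ε v w) (p : ℕ) :
    Indist δ ε (δ v p).1 (ε w p).1 := by
  intro σ
  have := h (p :: σ)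
  rw [history_cons, history_cons, h.entry_eq p] at this
  exact List.append_cancel_right this

/-- Bisimilar states are indistinguishable. -/
theorem indist_of_bisim (R : V → W → Prop)
    (hR : ∀ v w p, R v w → (δ v p).2 = (ε w p).2 ∧ R (δ v p).1 (ε w p).1) {v : V} {w : W}
    (h : R v w) : Indist δ ε v w := by
  intro σ
  induction σ generalizing v w with
  | nil => rfl
  | cons p σ ih =>
    rw [history_cons, history_cons, (hR v w p h).1, ih (hR v w p h).2]

/-- The entry port leads back to where the step began, so a step never merges distinguishable states
unless the step itself already tells them apart. -/
theorem Indist.of_next (hδ : Reversible δ) (hε : Reversible ε) {v : V} {w : W} {p : ℕ}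
    (he : (δ v p).2 = (ε w p).2) (h : Indist δ ε (δ v p).1 (ε w p).1) : Indist δ ε v w := by
  cases hq : (δ v p).2 with
  | none => rwa [hδ.stay v p hq, hε.stay w p (he ▸ hq)] at h
  | some q =>
    have := h.next q
    rwa [hδ.back v p q hq, hε.back w p q (he ▸ hq)] at this

/-- Used in contrapositive form: distinguishable states that a walk has failed to separate are still
distinguishable at its end, so the walk can be prolonged until it separates them. -/
theorem Indist.of_walk (hδ : Reversible δ) (hε : Reversible ε) (σ : List ℕ) {v : V} {w : W}
    (he : history δ v σ = history ε w σ)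
    (h : Indist δ ε (walk δ σ (v, [])).1 (walk ε σ (w, [])).1) : Indist δ ε v w := by
  induction σ generalizing v w with
  | nil => exact h
  | cons p σ ih =>
    rw [history_cons, history_cons] at he
    obtain ⟨h1, h2⟩ := List.append_inj' he rfl
    rw [walk_cons, walk_cons, walk_eq, walk_eq σ (ε w p).1] at h
    exact Indist.of_next hδ hε (by simpa using h2) (ih h1 h)

/-- One walk tells apart finitely many pairs of distinguishable states. -/
theorem exists_separating_walk (hδ : Reversible δ) (hε : Reversible ε) (S : Set (V × W))
    (hS : S.Finite) (h : ∀ s ∈ S, ¬ Indist δ ε s.1 s.2) :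
    ∃ σ, ∀ s ∈ S, history δ s.1 σ ≠ history ε s.2 σ := by
  induction S, hS using Set.Finite.induction_on with
  | empty => exact ⟨[], by simp⟩
  | @insert a S _ _ ih =>
    obtain ⟨σ, hσ⟩ := ih fun s hs => h s (Set.mem_insert_of_mem _ hs)
    -- Prolonging a walk does not undo a separation: the old history is a suffix of the new one, and
    -- suffixes of equal length can be compared.
    have key : ∀ τ, ∀ s ∈ S, history δ s.1 (σ ++ τ) ≠ history ε s.2 (σ ++ τ) := by
      intro τ s hs he
      rw [history_append, history_append] at he
      exact hσ s hs (List.append_inj_right he (by simp [length_history]))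
    by_cases ha : history δ a.1 σ = history ε a.2 σ
    · have h2 : ¬ Indist δ ε (walk δ σ (a.1, [])).1 (walk ε σ (a.2, [])).1 := fun h' =>
        h a (Set.mem_insert _ _) (Indist.of_walk hδ hε σ ha h')
      simp only [Indist, not_forall] at h2
      obtain ⟨τ, hτ⟩ := h2
      refine ⟨σ ++ τ, ?_⟩
      rintro s (rfl | hs)
      · intro he
        rw [history_append, history_append] at he
        exact hτ (List.append_inj_left he (by simp [length_history]))
      · exact key τ s hs
    · refine ⟨σ, ?_⟩
      rintro s (rfl | hs)
      · exact ha
      · exact hσ s hs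

end Walk

/-! ### Steps of an agent in a graph with port numbers -/

namespace PortGraph

variable (G : PortGraph)

/-- Leave `v` through the port `p`, or stay if there is no such port. -/
def go (v : Fin G.size) (p : ℕ) : Fin G.size × Option ℕ :=
  match G.follow v p with
  | some u => (u, some (G.port u v))
  | none => (v, none)

variable {G}

theorem port_ne_zero {u v : Fin G.size} (h : G.graph.Adj u v) : G.port u v ≠ 0 := by
  have := (G.port_bijOn u).mapsTo (x := v) h
  have := this.1
  omega

theorem port_ne_zero_iff {u v : Fin G.size} : G.port u v ≠ 0 ↔ G.graph.Adj u v :=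
  ⟨fun h => by_contra fun h' => h (G.port_eq_zero u v h'), port_ne_zero⟩

theorem port_inj {u v w : Fin G.size} (hv : G.graph.Adj u v) (h : G.port u v = G.port u w) :
    v = w :=
  (G.port_bijOn u).injOn hv (port_ne_zero_iff.1 (h ▸ port_ne_zero hv)) h

theorem follow_eq_some {u v : Fin G.size} {p : ℕ} :
    G.follow u p = some v ↔ G.graph.Adj u v ∧ G.port u v = p := by
  constructor
  · intro h
    have := List.find?_some h
    simp only [decide_eq_true_eq] at this
    exact ⟨port_ne_zero_iff.1 (this.2 ▸ this.1), this.2⟩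
  · rintro ⟨h, rfl⟩
    cases hf : G.follow u (G.port u v) with
    | none =>
      have := List.find?_eq_none.1 hf v (List.mem_finRange v)
      simp [port_ne_zero h] at this
    | some w =>
      have := List.find?_some hf
      simp only [decide_eq_true_eq] at this
      rw [port_inj h this.2.symm]

theorem go_of_adj {u v : Fin G.size} (h : G.graph.Adj u v) :
    G.go u (G.port u v) = (v, some (G.port v u)) := by
  simp [go, follow_eq_some.2 ⟨h, rfl⟩]

theorem adj_of_go {u : Fin G.size} {p q : ℕ} (h : (G.go u p).2 = some q) :
    G.graph.Adj u (G.go u p).1 ∧ G.port u (G.go u p).1 = p ∧ G.port (G.go u p).1 u = q := by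
  cases hf : G.follow u p with
  | none => simp [go, hf] at h
  | some w =>
    simp only [go, hf, Option.some.injEq] at h ⊢
    exact ⟨(follow_eq_some.1 hf).1, (follow_eq_some.1 hf).2, h⟩

theorem reversible_go : Reversible G.go where
  back v p q h := by
    obtain ⟨h1, h2, h3⟩ := adj_of_go h
    rw [← h3, go_of_adj h1.symm, h2]
  stay v p h := by
    cases hf : G.follow v p with
    | none => simp [go, hf]
    | some w => simp [go, hf] at h

theorem go_snd_ne_none_iff {u : Fin G.size} {p : ℕ} :
    (G.go u p).2 ≠ none ↔ p ∈ Set.Icc 1 (G.degree u) := by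
  rw [degree, ← (G.port_bijOn u).image_eq]
  constructor
  · intro h
    obtain ⟨q, hq⟩ := Option.ne_none_iff_exists'.1 h
    obtain ⟨h1, h2, -⟩ := adj_of_go hq
    exact ⟨_, h1, h2⟩
  · rintro ⟨v, hv, rfl⟩
    simp [go_of_adj hv]

/-- Histories do not record degrees, but a port exists exactly if the attempt to use it yields an
entry port. -/
theorem degree_eq_of_indist {G' : PortGraph} {u : Fin G.size} {v : Fin G'.size}
    (h : Indist G.go G'.go u v) : G.degree u = G'.degree v := by
  have : Set.Icc 1 (G.degree u) = Set.Icc 1 (G'.degree v) := by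
    ext p
    rw [← go_snd_ne_none_iff, ← go_snd_ne_none_iff, h.entry_eq]
  simpa using congrArg Set.ncard this

/-- Having the same view at every depth is a bisimulation, since the subtree below port `p` in the
view of depth `t + 1` is the view of depth `t` from the neighbor. Conversely, indistinguishability
passes to the neighbors, so the views agree by induction on the depth. -/
theorem viewSetoid_iff {u v : Fin G.size} : G.viewSetoid u v ↔ Indist G.go G.go u v := by
  constructor
  · refine indist_of_bisim (fun u v => G.viewSetoid u v) (fun u v p h => ?_)
    have key : ∀ t, (G.follow u p).map (fun x => (G.port x u, G.view t x)) =
        (G.follow v p).map (fun x => (G.port x v, G.view t x)) := fun t => by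
      have := h (t + 1)
      simp only [view, ViewTree.node.injEq] at this
      exact congrFun this p
    unfold go
    cases hu : G.follow u p with
    | none =>
      cases hv : G.follow v p with
      | none => exact ⟨rfl, h⟩
      | some y => simpa [hu, hv] using key 0
    | some x =>
      cases hv : G.follow v p with
      | none => simpa [hu, hv] using key 0
      | some y =>
        simp only [hu, hv, Option.map_some, Option.some.injEq, Prod.mk.injEq] at key
        exact ⟨congrArg some (key 0).1, fun t => (key t).2⟩
  · intro h t
    induction t generalizing u v with
    | zero => rfl
    | succ t ih =>
      simp only [view, ViewTree.node.injEq]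
      funext p
      have h1 := h.entry_eq p
      have h2 := h.next p
      unfold go at h1 h2
      cases hu : G.follow u p <;> cases hv : G.follow v p <;> simp only [hu, hv] at h1 h2
      · rfl
      · simp at h1
      · simp at h1
      · simp only [Option.some.injEq] at h1
        simp [h1, ih h2]

end PortGraph

/-! ### Steps along the darts in a list -/

/-- The first value that belongs to the key `a`. -/
def firstValue {α β : Type} [DecidableEq α] (l : List (α × β)) (a : α) : Option β := l.lookup a

/-- Leave `v` along the first dart that starts at `(v, p)`, or stay if there is none. -/
def dartStep {V : Type} [DecidableEq V] (D : List ((V × ℕ) × (V × ℕ))) (v : V) (p : ℕ) :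
    V × Option ℕ :=
  match firstValue D (v, p) with
  | some e => (e.1, some e.2)
  | none => (v, none)

/-- At most one dart starts at each node with each port. -/
def DartsFunctional {V : Type} (D : List ((V × ℕ) × (V × ℕ))) : Prop :=
  ∀ d ∈ D, ∀ e ∈ D, d.1 = e.1 → d.2 = e.2

section Darts

variable {V : Type} [DecidableEq V] {D : List ((V × ℕ) × (V × ℕ))}

theorem mem_of_firstValue_eq_some {α β : Type} [DecidableEq α] {a : α} {b : β} {l : List (α × β)}
    (h : firstValue l a = some b) : (a, b) ∈ l := by
  unfold firstValue at *
  induction l with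
  | nil => simp at h
  | cons c l ih =>
    obtain ⟨x, y⟩ := c
    rw [List.lookup_cons] at h
    by_cases hx : a = x
    · subst hx
      simp at h
      simp [h]
    · have : (a == x) = false := by simpa using hx
      rw [this] at h
      exact List.mem_cons_of_mem _ (ih h)

theorem firstValue_ne_none {α β : Type} [DecidableEq α] {a : α} {b : β} {l : List (α × β)}
    (h : (a, b) ∈ l) : firstValue l a ≠ none := by
  unfold firstValue at *
  induction l with
  | nil => simp at h
  | cons c l ih =>
    obtain ⟨x, y⟩ := c
    rw [List.lookup_cons]
    by_cases hx : a = x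
    · subst hx
      simp
    · have hf : (a == x) = false := by simpa using hx
      rw [hf]
      rcases List.mem_cons.1 h with h | h
      · simp_all
      · exact ih h

theorem dartStep_of_mem (hD : DartsFunctional D) {x y : V} {p q : ℕ} (h : ((x, p), (y, q)) ∈ D) :
    dartStep D x p = (y, some q) := by
  obtain ⟨e, he⟩ := Option.ne_none_iff_exists'.1 (firstValue_ne_none h)
  have := hD _ h _ (mem_of_firstValue_eq_some he) rfl
  simp only at this
  subst this
  simp [dartStep, he]

theorem mem_of_dartStep {x : V} {p q : ℕ} (h : (dartStep D x p).2 = some q) :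
    ((x, p), ((dartStep D x p).1, q)) ∈ D := by
  unfold dartStep at h ⊢
  cases he : firstValue D (x, p) with
  | none => simp [he] at h
  | some e =>
    simp only [he, Option.some.injEq] at h
    simpa [← h] using mem_of_firstValue_eq_some he

theorem reversible_dartStep (hD : DartsFunctional D) (hs : ∀ d ∈ D, d.swap ∈ D) :
    Reversible (dartStep D) where
  back v p q h := dartStep_of_mem hD (hs _ (mem_of_dartStep h))
  stay v p h := by
    unfold dartStep at h ⊢
    cases he : firstValue D (v, p) with
    | none => simp
    | some e => simp [he] at h

end Darts

/-! ### Recognizing the quotient graph by indistinguishability -/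

/-- The edges in the list, in both directions. -/
def bothWays {V : Type} (L : List ((V × ℕ) × (V × ℕ))) : List ((V × ℕ) × (V × ℕ)) :=
  L ++ L.map Prod.swap

theorem swap_mem_bothWays {V : Type} {L : List ((V × ℕ) × (V × ℕ))} :
    ∀ d ∈ bothWays L, d.swap ∈ bothWays L := by
  intro d hd
  simp only [bothWays, List.mem_append, List.mem_map] at hd ⊢
  rcases hd with hd | ⟨e, he, rfl⟩
  · exact .inr ⟨d, hd, rfl⟩
  · exact .inl (by simpa using he)

theorem mem_bothWays {V : Type} {L : List ((V × ℕ) × (V × ℕ))} {a b : V × ℕ} :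
    (a, b) ∈ bothWays L ↔ ∃ d ∈ L, s(a, b) = s(d.1, d.2) := by
  simp only [bothWays, List.mem_append, List.mem_map, Sym2.eq_iff]
  constructor
  · rintro (h | ⟨e, he, h⟩)
    · exact ⟨_, h, .inl ⟨rfl, rfl⟩⟩
    · refine ⟨e, he, .inr ?_⟩
      rw [← Prod.mk.injEq, ← h]
      rfl
  · rintro ⟨d, hd, ⟨rfl, rfl⟩ | ⟨rfl, rfl⟩⟩
    · exact .inl hd
    · exact .inr ⟨d, hd, rfl⟩

/-- The darts of the graph that is presented. -/
def GivenGraph.darts (H : GivenGraph) : List ((Fin H.size × ℕ) × (Fin H.size × ℕ)) :=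
  bothWays H.edgeList

theorem GivenGraph.mem_edges {H : GivenGraph} {a b : Fin H.size × ℕ} :
    s(a, b) ∈ H.toMultigraph.edges ↔ (a, b) ∈ H.darts :=
  mem_bothWays.symm

theorem PortGraph.mem_quotient_edges {G : PortGraph} {x y : Quotient G.viewSetoid} {p q : ℕ} :
    s((x, p), (y, q)) ∈ G.quotient.edges ↔ ∃ u v, G.graph.Adj u v ∧ Quotient.mk _ u = x ∧
      Quotient.mk _ v = y ∧ G.port u v = p ∧ G.port v u = q := by
  constructor
  · rintro ⟨u, v, h, he⟩
    simp only [Sym2.eq_iff, Prod.mk.injEq] at he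
    rcases he with ⟨⟨h1, h2⟩, h3, h4⟩ | ⟨⟨h1, h2⟩, h3, h4⟩
    · exact ⟨u, v, h, h1.symm, h3.symm, h2.symm, h4.symm⟩
    · exact ⟨v, u, h.symm, h1.symm, h3.symm, h2.symm, h4.symm⟩
  · rintro ⟨u, v, h, rfl, rfl, rfl, rfl⟩
    exact ⟨u, v, h, rfl⟩

/-- A map from the nodes of `G` onto those of `H` that induces an isomorphism from the quotient
graph of `G` to `H`. -/
structure IsQuotientMap (G : PortGraph) (H : GivenGraph) (f : Fin G.size → Fin H.size) : Prop where
  surjective : Function.Surjective f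
  eq_iff : ∀ u v, f u = f v ↔ Indist G.go G.go u v
  mem_darts : ∀ x p y q, ((x, p), (y, q)) ∈ H.darts ↔
    ∃ u v, G.graph.Adj u v ∧ f u = x ∧ f v = y ∧ G.port u v = p ∧ G.port v u = q

/-- An isomorphism composed with the projection to the classes is such a map. Conversely such a map
is constant on classes and descends to a bijection. -/
theorem isIsomorphic_iff_exists_isQuotientMap {G : PortGraph} {H : GivenGraph} :
    G.quotient.IsIsomorphic H.toMultigraph ↔ ∃ f, IsQuotientMap G H f := by
  constructor
  · rintro ⟨φ, hφ⟩
    refine ⟨fun u => φ (Quotient.mk _ u), ?_, ?_, ?_⟩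
    · exact φ.surjective.comp Quotient.mk_surjective
    · intro u v
      rw [φ.apply_eq_iff_eq, Quotient.eq, PortGraph.viewSetoid_iff]
    · intro x p y q
      rw [← GivenGraph.mem_edges, ← hφ]
      have hs : s((x, p), (y, q)) =
          Sym2.map (Prod.map φ id) s((φ.symm x, p), (φ.symm y, q)) := by simp
      rw [hs, (Sym2.map.injective (φ.injective.prodMap Function.injective_id)).mem_set_image,
        PortGraph.mem_quotient_edges]
      simp only [Equiv.eq_symm_apply]
  · rintro ⟨f, hf⟩
    let g : Quotient G.viewSetoid → Fin H.size := Quotient.lift f fun u v h =>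
      (hf.eq_iff u v).2 (PortGraph.viewSetoid_iff.1 h)
    have hg : Function.Bijective g := by
      constructor
      · intro x y
        refine Quotient.inductionOn₂ x y fun u v h => ?_
        exact Quotient.sound (PortGraph.viewSetoid_iff.2 ((hf.eq_iff u v).1 h))
      · intro x
        obtain ⟨u, rfl⟩ := hf.surjective x
        exact ⟨Quotient.mk _ u, rfl⟩
    let φ := Equiv.ofBijective g hg
    refine ⟨φ, ?_⟩
    ext e
    induction e using Sym2.inductionOn with
    | _ a b =>
    obtain ⟨x, p⟩ := a
    obtain ⟨y, q⟩ := b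
    have hs : s((x, p), (y, q)) =
        Sym2.map (Prod.map φ id) s((φ.symm x, p), (φ.symm y, q)) := by simp
    rw [GivenGraph.mem_edges, hf.mem_darts, hs,
      (Sym2.map.injective (φ.injective.prodMap Function.injective_id)).mem_set_image,
      PortGraph.mem_quotient_edges]
    simp only [Equiv.eq_symm_apply]
    rfl

namespace IsQuotientMap

variable {G : PortGraph} {H : GivenGraph} {f : Fin G.size → Fin H.size}

/-- Two darts of `H` with the same origin lift to edges of `G` that leave indistinguishable nodes
through the same port, hence arrive at indistinguishable nodes through the same entry port. -/
theorem functional (hf : IsQuotientMap G H f) : DartsFunctional H.darts := by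
  rintro ⟨⟨x, p⟩, ⟨y, q⟩⟩ hd ⟨⟨x', p'⟩, ⟨y', q'⟩⟩ he h
  obtain ⟨u, v, ha, h1, h2, h3, h4⟩ := (hf.mem_darts _ _ _ _).1 hd
  obtain ⟨u', v', ha', h1', h2', h3', h4'⟩ := (hf.mem_darts _ _ _ _).1 he
  simp only [Prod.mk.injEq] at h ⊢
  have hu : Indist G.go G.go u u' := (hf.eq_iff _ _).1 (by rw [h1, h1', h.1])
  have e1 := hu.entry_eq p
  have e2 := hu.next p
  nth_rewrite 1 [← h3] at e1 e2
  rw [h.2, ← h3', PortGraph.go_of_adj ha, PortGraph.go_of_adj ha'] at e1 e2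
  constructor
  · rw [← h2, ← h2', hf.eq_iff]
    exact e2
  · rw [← h4, ← h4']
    simpa using e1

theorem indist (hf : IsQuotientMap G H f) (u : Fin G.size) :
    Indist G.go (dartStep H.darts) u (f u) := by
  refine indist_of_bisim (fun u x => f u = x) ?_ rfl
  rintro u _ p rfl
  cases h : (G.go u p).2 with
  | some q =>
    obtain ⟨h1, h2, h3⟩ := PortGraph.adj_of_go h
    rw [dartStep_of_mem hf.functional ((hf.mem_darts _ _ _ _).2 ⟨_, _, h1, rfl, rfl, h2, h3⟩)]
    simp
  | none =>
    -- A dart of `H` at `f u` need not come from an edge at `u` itself, but it comes from one at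
    -- another node of the same fiber, and that node has the same ports as `u`.
    have hn : (dartStep H.darts (f u) p).2 = none := by
      by_contra h'
      obtain ⟨q, hq⟩ := Option.ne_none_iff_exists'.1 h'
      obtain ⟨u', v', ha, h1, h2, h3, h4⟩ := (hf.mem_darts _ _ _ _).1 (mem_of_dartStep hq)
      have := ((hf.eq_iff _ _).1 h1).entry_eq p
      rw [h, ← h3, PortGraph.go_of_adj ha] at this
      simp at this
    rw [hn, (reversible_dartStep hf.functional swap_mem_bothWays).stay _ _ hn,
      PortGraph.reversible_go.stay _ _ h]
    simp

theorem eq_of_indist (hf : IsQuotientMap G H f) {x y : Fin H.size}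
    (h : Indist (dartStep H.darts) (dartStep H.darts) x y) : x = y := by
  obtain ⟨u, rfl⟩ := hf.surjective x
  obtain ⟨v, rfl⟩ := hf.surjective y
  exact (hf.eq_iff u v).2 (((hf.indist u).trans h).trans (hf.indist v).symm)

end IsQuotientMap

/-- One matching pair of nodes is enough. Walking through `G` carries the match to every node, which
defines the map; lifting the darts of `H` along a path in `H` shows that it is onto. -/
theorem exists_isQuotientMap {G : PortGraph} {H : GivenGraph} (hD : DartsFunctional H.darts)
    (hH : ∀ x y, Indist (dartStep H.darts) (dartStep H.darts) x y → x = y) {s : Fin G.size}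
    {h : Fin H.size} (hs : Indist G.go (dartStep H.darts) s h) : ∃ f, IsQuotientMap G H f := by
  have hne : ∀ u, ∃ x, Indist G.go (dartStep H.darts) u x := by
    intro u
    obtain ⟨w⟩ := G.connected.preconnected s u
    induction w generalizing h with
    | nil => exact ⟨h, hs⟩
    | @cons a b _ ha _ ih =>
      have := hs.next (G.port a b)
      rw [PortGraph.go_of_adj ha] at this
      exact ih this
  choose f hf using hne
  have huniq : ∀ u x, Indist G.go (dartStep H.darts) u x → f u = x := fun u x hx =>
    hH _ _ ((hf u).symm.trans hx)
  -- Every dart of `H` lifts to an edge at any prescribed node above its origin.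
  have hlift : ∀ u p y q, ((f u, p), (y, q)) ∈ H.darts →
      ∃ v, G.graph.Adj u v ∧ f v = y ∧ G.port u v = p ∧ G.port v u = q := by
    intro u p y q hd
    have h1 := (hf u).entry_eq p
    have h2 := (hf u).next p
    rw [dartStep_of_mem hD hd] at h1 h2
    obtain ⟨ha, hp, hq⟩ := PortGraph.adj_of_go h1
    exact ⟨_, ha, huniq _ _ h2, hp, hq⟩
  have hsurj : Function.Surjective f := by
    intro x
    obtain ⟨w⟩ := H.connected.preconnected (f s) x
    have : ∀ y z : Fin H.size, (SimpleGraph.fromRel fun x y : Fin H.size =>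
        ∃ p q, s((x, p), (y, q)) ∈ (PortMultigraph.ofList H.edgeList).edges).Walk y z →
        (∃ u, f u = y) → ∃ u, f u = z := by
      intro y z w
      induction w with
      | nil => exact id
      | @cons a b _ ha _ ih =>
        rintro ⟨u, rfl⟩
        apply ih
        rw [SimpleGraph.fromRel_adj] at ha
        obtain ⟨-, ⟨p, q, hpq⟩ | ⟨p, q, hpq⟩⟩ := ha
        · obtain ⟨v, -, hv, -⟩ := hlift u p _ q (GivenGraph.mem_edges.1 hpq)
          exact ⟨v, hv⟩
        · rw [Sym2.eq_swap] at hpq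
          obtain ⟨v, -, hv, -⟩ := hlift u q _ p (GivenGraph.mem_edges.1 hpq)
          exact ⟨v, hv⟩
    exact this _ _ w ⟨s, rfl⟩
  refine ⟨f, hsurj, ?_, ?_⟩
  · intro u v
    constructor
    · intro he
      exact (hf u).trans (he ▸ (hf v).symm)
    · intro he
      exact huniq _ _ (he.trans (hf v))
  · intro x p y q
    constructor
    · intro hd
      obtain ⟨u, rfl⟩ := hsurj x
      obtain ⟨v, hv⟩ := hlift u p y q hd
      exact ⟨u, v, hv.1, rfl, hv.2⟩
    · rintro ⟨u, v, ha, rfl, rfl, rfl, rfl⟩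
      have h1 := (hf u).entry_eq (G.port u v)
      have h2 := (hf u).next (G.port u v)
      rw [PortGraph.go_of_adj ha] at h1 h2
      have := mem_of_dartStep h1.symm
      rwa [← huniq _ _ h2] at this

/-- The quotient graph of `G` is `H` exactly if the darts of `H` leave by distinct ports, walks
distinguish the nodes of `H`, and one of these cannot be distinguished from the node `s` of `G`. -/
theorem isIsomorphic_iff {G : PortGraph} {H : GivenGraph} (s : Fin G.size) :
    G.quotient.IsIsomorphic H.toMultigraph ↔ DartsFunctional H.darts ∧
      (∀ x y, Indist (dartStep H.darts) (dartStep H.darts) x y → x = y) ∧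
      ∃ h, Indist G.go (dartStep H.darts) s h := by
  rw [isIsomorphic_iff_exists_isQuotientMap]
  constructor
  · rintro ⟨f, hf⟩
    exact ⟨hf.functional, fun _ _ => hf.eq_of_indist, f s, hf.indist s⟩
  · rintro ⟨hD, hH, h, hs⟩
    exact exists_isQuotientMap hD hH hs

/-! ### Primitive recursive predicates with bounded quantifiers -/

section Primrec

variable {α β γ : Type} [Primcodable α] [Primcodable β] [Primcodable γ]

theorem primrecPred_forall_mem {f : α → List β} {R : α → β → Prop} (hf : Primrec f)
    (hR : PrimrecPred fun x : α × β => R x.1 x.2) : PrimrecPred fun a => ∀ b ∈ f a, R a b :=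
  PrimrecRel.comp (R := fun (L : List β) a => ∀ b ∈ L, R a b)
    (PrimrecRel.forall_mem_list (R := fun b a => R a b)
      (hR.comp (Primrec.pair Primrec.snd Primrec.fst))) hf Primrec.id

theorem primrecPred_exists_mem {f : α → List β} {R : α → β → Prop} (hf : Primrec f)
    (hR : PrimrecPred fun x : α × β => R x.1 x.2) : PrimrecPred fun a => ∃ b ∈ f a, R a b :=
  PrimrecRel.comp (R := fun (L : List β) a => ∃ b ∈ L, R a b)
    (PrimrecRel.exists_mem_list (R := fun b a => R a b)
      (hR.comp (Primrec.pair Primrec.snd Primrec.fst))) hf Primrec.id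

theorem primrecPred_forall_lt {f : α → ℕ} {R : α → ℕ → Prop} (hf : Primrec f)
    (hR : PrimrecPred fun x : α × ℕ => R x.1 x.2) : PrimrecPred fun a => ∀ b < f a, R a b :=
  (primrecPred_forall_mem (Primrec.list_range.comp hf) hR).of_eq fun a => by simp

theorem primrecPred_exists_lt {f : α → ℕ} {R : α → ℕ → Prop} (hf : Primrec f)
    (hR : PrimrecPred fun x : α × ℕ => R x.1 x.2) : PrimrecPred fun a => ∃ b < f a, R a b :=
  (primrecPred_exists_mem (Primrec.list_range.comp hf) hR).of_eq fun a => by simp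

theorem primrecPred_imp {p q : α → Prop} (hp : PrimrecPred p) (hq : PrimrecPred q) :
    PrimrecPred fun a => p a → q a :=
  (hp.not.or hq).of_eq fun _ => imp_iff_not_or.symm

theorem primrecPred_eq {f g : α → β} (hf : Primrec f) (hg : Primrec g) :
    PrimrecPred fun a => f a = g a := PrimrecRel.comp Primrec.eq hf hg

theorem primrecPred_lt {f g : α → ℕ} (hf : Primrec f) (hg : Primrec g) :
    PrimrecPred fun a => f a < g a := PrimrecRel.comp Primrec.nat_lt hf hg

theorem primrecPred_mem {f : α → List β} {g : α → β} (hf : Primrec f) (hg : Primrec g) :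
    PrimrecPred fun a => g a ∈ f a :=
  (primrecPred_exists_mem (R := fun a b => b = g a) hf
    (primrecPred_eq Primrec.snd (hg.comp Primrec.fst))).of_eq fun a => by simp

end Primrec

/-! ### Computing with darts -/

/-- Darts between nodes that are natural numbers. -/
abbrev Darts : Type := List ((ℕ × ℕ) × (ℕ × ℕ))

/-- The nodes that are reached from the node `0` along at most `k` darts. -/
def reached (D : Darts) (k : ℕ) : List ℕ :=
  k.rec [0] fun _ R => R ++ D.filterMap fun d => if d.1.1 ∈ R then some d.2.1 else none

/-- There is a node `0`, and all nodes `0, …, n - 1` can be reached from it. -/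
def DartsConnected (n : ℕ) (D : Darts) : Prop := 0 < n ∧ ∀ v < n, v ∈ reached D n

theorem primrec_reached : Primrec₂ reached := by
  refine Primrec.nat_rec (f := fun _ : Darts => [0]) (g := fun (D : Darts) (x : ℕ × List ℕ) =>
    x.2 ++ D.filterMap fun d => if d.1.1 ∈ x.2 then some d.2.1 else none)
    (Primrec.const _) ?_
  refine Primrec.list_append.comp (Primrec.snd.comp Primrec.snd) ?_
  refine Primrec.listFilterMap Primrec.fst ?_
  have hd : Primrec fun x : (Darts × ℕ × List ℕ) × ((ℕ × ℕ) × (ℕ × ℕ)) => x.2 := Primrec.snd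
  have hR : Primrec fun x : (Darts × ℕ × List ℕ) × ((ℕ × ℕ) × (ℕ × ℕ)) => x.1.2.2 :=
    Primrec.snd.comp (Primrec.snd.comp Primrec.fst)
  exact (Primrec.ite (primrecPred_mem hR (Primrec.fst.comp (Primrec.fst.comp hd)))
    (Primrec.option_some.comp (Primrec.fst.comp (Primrec.snd.comp hd))) (Primrec.const none))

theorem primrecPred_dartsConnected : PrimrecPred fun x : ℕ × Darts => DartsConnected x.1 x.2 := by
  refine (primrecPred_lt (Primrec.const 0) Primrec.fst).and
    (primrecPred_forall_lt (R := fun (x : ℕ × Darts) v => v ∈ reached x.2 x.1) Primrec.fst ?_)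
  exact primrecPred_mem (primrec_reached.comp (Primrec.snd.comp Primrec.fst)
    (Primrec.fst.comp Primrec.fst)) Primrec.snd

theorem reached_succ (D : Darts) (k : ℕ) : reached D (k + 1) = reached D k ++
    D.filterMap fun d => if d.1.1 ∈ reached D k then some d.2.1 else none := rfl

theorem reached_mono (D : Darts) {j k : ℕ} (h : j ≤ k) : reached D j ⊆ reached D k := by
  induction h with
  | refl => exact List.Subset.refl _
  | step _ ih =>
    rw [reached_succ]
    exact List.Subset.trans ih (List.subset_append_left _ _)

theorem mem_reached_succ {D : Darts} {k u v p q : ℕ} (hu : u ∈ reached D k)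
    (h : ((u, p), (v, q)) ∈ D) : v ∈ reached D (k + 1) := by
  rw [reached_succ, List.mem_append, List.mem_filterMap]
  exact .inr ⟨_, h, by simp [hu]⟩

/-- A path in a graph with `n` nodes has fewer than `n` edges, so `n` rounds reach everything. The
condition `u ≠ v` leaves room for self-loops among the darts, which `A` cannot have and which do not
affect reachability. -/
theorem dartsConnected_iff {n : ℕ} {A : SimpleGraph (Fin n)} {D : Darts}
    (h1 : ∀ u v, A.Adj u v → ∃ p q, ((u.val, p), (v.val, q)) ∈ D)
    (h2 : ∀ u p v q, ((u, p), (v, q)) ∈ D → ∃ (hu : u < n) (hv : v < n),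
      u ≠ v → A.Adj ⟨u, hu⟩ ⟨v, hv⟩) : DartsConnected n D ↔ A.Connected := by
  constructor
  · rintro ⟨hn, h⟩
    have key : ∀ k v, v ∈ reached D k → ∃ hv : v < n, A.Reachable ⟨0, hn⟩ ⟨v, hv⟩ := by
      intro k
      induction k with
      | zero =>
        intro v hv
        obtain rfl : v = 0 := by simpa [reached] using hv
        exact ⟨hn, .refl _⟩
      | succ k ih =>
        intro v hv
        rw [reached_succ, List.mem_append, List.mem_filterMap] at hv
        rcases hv with hv | ⟨⟨⟨u, p⟩, ⟨w, q⟩⟩, hd, hv⟩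
        · exact ih v hv
        · simp only [Option.ite_none_right_eq_some, Option.some.injEq] at hv
          obtain ⟨hu, rfl⟩ := hv
          obtain ⟨hu', hw, hA⟩ := h2 _ _ _ _ hd
          obtain ⟨_, hr⟩ := ih u hu
          refine ⟨hw, ?_⟩
          by_cases he : u = w
          · subst he
            exact hr
          · exact hr.trans (hA he).reachable
    have : Nonempty (Fin n) := ⟨⟨0, hn⟩⟩
    refine SimpleGraph.Connected.mk fun u v => ?_
    obtain ⟨_, hu⟩ := key n u (h u u.2)
    obtain ⟨_, hv⟩ := key n v (h v v.2)
    exact hu.symm.trans hv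
  · intro hA
    obtain ⟨z⟩ := hA.nonempty
    have hn : 0 < n := z.pos
    refine ⟨hn, fun v hv => ?_⟩
    obtain ⟨w, hw⟩ := hA.exists_isPath ⟨0, hn⟩ ⟨v, hv⟩
    have key : ∀ (a b : Fin n) (w : A.Walk a b) k, a.val ∈ reached D k →
        b.val ∈ reached D (k + w.length) := by
      intro a b w
      induction w with
      | nil => exact fun k h => h
      | cons ha _ ih =>
        intro k hk
        obtain ⟨p, q, hd⟩ := h1 _ _ ha
        have := ih _ (mem_reached_succ hk hd)
        rwa [add_assoc, add_comm 1] at this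
    have := key _ _ w 0 (by simp [reached])
    have hl := hw.length_lt
    rw [Fintype.card_fin] at hl
    exact reached_mono D (by omega) this

theorem primrec_firstValue {α β : Type} [Primcodable α] [Primcodable β] [DecidableEq α] :
    Primrec₂ (firstValue : List (α × β) → α → Option β) :=
  Primrec.listLookup.comp Primrec.snd Primrec.fst

theorem primrec_dartStep :
    Primrec fun x : Darts × ℕ × ℕ => dartStep x.1 x.2.1 x.2.2 := by
  have h : Primrec fun x : Darts × ℕ × ℕ => firstValue x.1 x.2 :=
    primrec_firstValue.comp Primrec.fst Primrec.snd
  refine (Primrec.option_casesOn (f := fun x : Darts × ℕ × ℕ => (x.2.1, (none : Option ℕ)))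
    (g := fun (_ : Darts × ℕ × ℕ) (e : ℕ × ℕ) => (e.1, some e.2)) h
    (Primrec.pair (Primrec.fst.comp Primrec.snd) (Primrec.const none))
    (Primrec.pair (Primrec.fst.comp Primrec.snd)
      (Primrec.option_some.comp (Primrec.snd.comp Primrec.snd)))).of_eq ?_
  rintro ⟨D, u, p⟩
  simp only [dartStep]
  cases firstValue D (u, p) <;> rfl

theorem primrec_history :
    Primrec fun x : Darts × ℕ × List ℕ => history (dartStep x.1) x.2.1 x.2.2 := by
  refine Primrec.snd.comp (Primrec.list_foldl (f := fun x : Darts × ℕ × List ℕ => x.2.2)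
    (g := fun x => (x.2.1, ([] : List (Option ℕ))))
    (h := fun x s => ((dartStep x.1 s.1.1 s.2).1, (dartStep x.1 s.1.1 s.2).2 :: s.1.2))
    (Primrec.snd.comp Primrec.snd)
    (Primrec.pair (Primrec.fst.comp Primrec.snd) (Primrec.const [])) ?_)
  have hs : Primrec fun y : (Darts × ℕ × List ℕ) × (ℕ × List (Option ℕ)) × ℕ =>
      dartStep y.1.1 y.2.1.1 y.2.2 :=
    primrec_dartStep.comp (Primrec.pair (Primrec.fst.comp Primrec.fst)
      (Primrec.pair (Primrec.fst.comp (Primrec.fst.comp Primrec.snd))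
        (Primrec.snd.comp Primrec.snd)))
  exact Primrec.pair (Primrec.fst.comp hs) (Primrec.list_cons.comp (Primrec.snd.comp hs)
    (Primrec.snd.comp (Primrec.fst.comp Primrec.snd)))

theorem primrec_bothWays : Primrec (bothWays : Darts → Darts) :=
  Primrec.list_append.comp Primrec.id (Primrec.list_map Primrec.id
    ((Primrec.pair Primrec.snd Primrec.fst).comp Primrec.snd))

theorem primrecPred_dartsFunctional : PrimrecPred fun D : Darts => DartsFunctional D := by
  refine primrecPred_forall_mem Primrec.id (R := fun (D : Darts) d => ∀ e ∈ D, d.1 = e.1 → d.2 = e.2)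
    (primrecPred_forall_mem Primrec.fst
      (R := fun (x : Darts × ((ℕ × ℕ) × (ℕ × ℕ))) e => x.2.1 = e.1 → x.2.2 = e.2) ?_)
  have hd : Primrec fun y : (Darts × ((ℕ × ℕ) × (ℕ × ℕ))) × ((ℕ × ℕ) × (ℕ × ℕ)) => y.1.2 :=
    Primrec.snd.comp Primrec.fst
  exact primrecPred_imp (primrecPred_eq (Primrec.fst.comp hd) (Primrec.fst.comp Primrec.snd))
    (primrecPred_eq (Primrec.snd.comp hd) (Primrec.snd.comp Primrec.snd))

/-- Every dart of `D` can be imitated by one of `D'` at each node `v' < n'` of the same color. -/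
def Imitates (n' : ℕ) (D D' : Darts) (c c' : List ℕ) : Prop :=
  ∀ d ∈ D, ∀ v < n', c.getD d.1.1 0 = c'.getD v 0 →
    ∃ d' ∈ D', d'.1 = (v, d.1.2) ∧ d'.2.2 = d.2.2 ∧ c.getD d.2.1 0 = c'.getD d'.2.1 0

theorem primrecPred_imitates :
    PrimrecPred fun x : ℕ × Darts × Darts × List ℕ × List ℕ =>
      Imitates x.1 x.2.1 x.2.2.1 x.2.2.2.1 x.2.2.2.2 := by
  let X := ℕ × Darts × Darts × List ℕ × List ℕ
  refine primrecPred_forall_mem (R := fun (x : X) d => ∀ v < x.1,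
    x.2.2.2.1.getD d.1.1 0 = x.2.2.2.2.getD v 0 → ∃ d' ∈ x.2.2.1, d'.1 = (v, d.1.2) ∧
      d'.2.2 = d.2.2 ∧ x.2.2.2.1.getD d.2.1 0 = x.2.2.2.2.getD d'.2.1 0)
    (Primrec.fst.comp Primrec.snd)
    (primrecPred_forall_lt (R := fun (x : X × ((ℕ × ℕ) × (ℕ × ℕ))) v =>
      x.1.2.2.2.1.getD x.2.1.1 0 = x.1.2.2.2.2.getD v 0 → ∃ d' ∈ x.1.2.2.1, d'.1 = (v, x.2.1.2) ∧
      d'.2.2 = x.2.2.2 ∧ x.1.2.2.2.1.getD x.2.2.1 0 = x.1.2.2.2.2.getD d'.2.1 0)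
      (Primrec.fst.comp Primrec.fst) ?_)
  have hx : Primrec fun y : (X × ((ℕ × ℕ) × (ℕ × ℕ))) × ℕ => y.1.1 := Primrec.fst.comp Primrec.fst
  have hD' : Primrec fun x : X => x.2.2.1 := Primrec.fst.comp (Primrec.snd.comp Primrec.snd)
  have hc : Primrec fun x : X => x.2.2.2.1 :=
    Primrec.fst.comp (Primrec.snd.comp (Primrec.snd.comp Primrec.snd))
  have hc' : Primrec fun x : X => x.2.2.2.2 :=
    Primrec.snd.comp (Primrec.snd.comp (Primrec.snd.comp Primrec.snd))
  have hd : Primrec fun y : (X × ((ℕ × ℕ) × (ℕ × ℕ))) × ℕ => y.1.2 := Primrec.snd.comp Primrec.fst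
  refine primrecPred_imp (primrecPred_eq
    ((Primrec.list_getD 0).comp (hc.comp hx) (Primrec.fst.comp (Primrec.fst.comp hd)))
    ((Primrec.list_getD 0).comp (hc'.comp hx) Primrec.snd))
    (primrecPred_exists_mem (R := fun (y : (X × ((ℕ × ℕ) × (ℕ × ℕ))) × ℕ) d' =>
      d'.1 = (y.2, y.1.2.1.2) ∧ d'.2.2 = y.1.2.2.2 ∧
        y.1.1.2.2.2.1.getD y.1.2.2.1 0 = y.1.1.2.2.2.2.getD d'.2.1 0) (hD'.comp hx) ?_)
  refine (primrecPred_eq (Primrec.fst.comp Primrec.snd) (Primrec.pair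
    (Primrec.snd.comp Primrec.fst)
    (Primrec.snd.comp (Primrec.fst.comp (hd.comp Primrec.fst))))).and
    ((primrecPred_eq (Primrec.snd.comp (Primrec.snd.comp Primrec.snd))
      (Primrec.snd.comp (Primrec.snd.comp (hd.comp Primrec.fst)))).and
    (primrecPred_eq ((Primrec.list_getD 0).comp (hc.comp (hx.comp Primrec.fst))
      (Primrec.fst.comp (Primrec.snd.comp (hd.comp Primrec.fst))))
    ((Primrec.list_getD 0).comp (hc'.comp (hx.comp Primrec.fst))
      (Primrec.fst.comp (Primrec.snd.comp Primrec.snd)))))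

/-- Colorings that imitate one another's darts are bisimulations. -/
theorem indist_of_imitates {n n' : ℕ} {D D' : Darts} {c c' : List ℕ} (hD : DartsFunctional D)
    (hD' : DartsFunctional D') (hn : ∀ d ∈ D, d.2.1 < n) (hn' : ∀ d ∈ D', d.2.1 < n')
    (h : Imitates n' D D' c c') (h' : Imitates n D' D c' c) {u v : ℕ} (hu : u < n) (hv : v < n')
    (huv : c.getD u 0 = c'.getD v 0) : Indist (dartStep D) (dartStep D') u v := by
  -- The bounds belong to the relation because `Imitates` promises nothing about nodes outside the
  -- range, where colors are meaningless default values.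
  refine indist_of_bisim (fun u v => u < n ∧ v < n' ∧ c.getD u 0 = c'.getD v 0) ?_ ⟨hu, hv, huv⟩
  clear hu hv huv u v
  rintro u v p ⟨hu, hv, huv⟩
  cases hp : (dartStep D u p).2 with
  | some q =>
    have hd := mem_of_dartStep hp
    obtain ⟨⟨a, b, q'⟩, hd', h1, h2, h3⟩ := h _ hd v hv huv
    simp only at h1 h2 h3
    subst h1 h2
    rw [dartStep_of_mem hD' hd']
    exact ⟨rfl, hn _ hd, hn' _ hd', h3⟩
  | none =>
    cases hp' : (dartStep D' v p).2 with
    | some q =>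
      obtain ⟨⟨a, b, q'⟩, hd', h1, h2, h3⟩ := h' _ (mem_of_dartStep hp') u hu huv.symm
      simp only at h1 h2 h3
      subst h1 h2
      rw [dartStep_of_mem hD hd'] at hp
      simp at hp
    | none =>
      refine ⟨rfl, ?_⟩
      have : ∀ (E : Darts) w, (dartStep E w p).2 = none → (dartStep E w p).1 = w := by
        intro E w hw
        unfold dartStep at hw ⊢
        cases he : firstValue E (w, p) with
        | none => simp
        | some e => simp [he] at hw
      rw [this D u hp, this D' v hp']
      exact ⟨hu, hv, huv⟩

/-- Such evidence always exists: coloring the nodes of both graphs by their classes of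
indistinguishability passes the finite test `Imitates`. -/
theorem imitates_of_indist {n n' : ℕ} {D D' : Darts} {c c' : List ℕ} (hD : DartsFunctional D)
    (hn : ∀ d ∈ D, d.1.1 < n ∧ d.2.1 < n) (hn' : ∀ d ∈ D', d.2.1 < n')
    (h : ∀ u < n, ∀ v < n', (c.getD u 0 = c'.getD v 0 ↔ Indist (dartStep D) (dartStep D') u v)) :
    Imitates n' D D' c c' := by
  rintro ⟨⟨u, p⟩, ⟨w, q⟩⟩ hd v hv huv
  have hi := (h u (hn _ hd).1 v hv).1 huv
  have h1 := hi.entry_eq p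
  have h2 := hi.next p
  rw [dartStep_of_mem hD hd] at h1 h2
  have hm := mem_of_dartStep h1.symm
  exact ⟨_, hm, rfl, rfl, (h w (hn _ hd).2 _ (hn' _ hm)).2 h2⟩

/-! ### Matrices of port numbers -/

/-- An entry of a matrix; it is `0` outside the matrix. -/
def entry (M : List (List ℕ)) (u v : ℕ) : ℕ := (M.getD u []).getD v 0

/-- The darts that are described by a matrix of port numbers. -/
def matrixDarts (M : List (List ℕ)) : Darts :=
  (List.range M.length).flatMap fun u => (List.range M.length).flatMap fun v =>
    if entry M u v = 0 then [] else [((u, entry M u v), (v, entry M v u))]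

/-- The matrix of the port numbers. -/
def PortGraph.matrix (G : PortGraph) : List (List ℕ) :=
  List.ofFn fun u => List.ofFn fun v => G.port u v

/-- The conditions that characterize the matrices of port numbers. -/
def IsPortMatrix (M : List (List ℕ)) : Prop :=
  (∀ r ∈ M, r.length = M.length) ∧
  (∀ u < M.length, entry M u u = 0 ∧ ∀ v < M.length, entry M u v ≠ 0 → entry M v u ≠ 0 ∧
    (∀ w < M.length, entry M u v = entry M u w → v = w) ∧
    (∀ k < entry M u v, k ≠ 0 → ∃ w < M.length, entry M u w = k)) ∧
  DartsConnected M.length (matrixDarts M)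

theorem primrec_entry : Primrec fun x : List (List ℕ) × ℕ × ℕ => entry x.1 x.2.1 x.2.2 :=
  (Primrec.list_getD 0).comp ((Primrec.list_getD []).comp Primrec.fst
    (Primrec.fst.comp Primrec.snd)) (Primrec.snd.comp Primrec.snd)

theorem primrec_matrixDarts : Primrec matrixDarts := by
  refine Primrec.list_flatMap (Primrec.list_range.comp Primrec.list_length)
    (Primrec.list_flatMap (Primrec.list_range.comp (Primrec.list_length.comp Primrec.fst)) ?_)
  have hM : Primrec fun x : (List (List ℕ) × ℕ) × ℕ => x.1.1 := Primrec.fst.comp Primrec.fst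
  have hu : Primrec fun x : (List (List ℕ) × ℕ) × ℕ => x.1.2 := Primrec.snd.comp Primrec.fst
  have h1 : Primrec fun x : (List (List ℕ) × ℕ) × ℕ => entry x.1.1 x.1.2 x.2 :=
    primrec_entry.comp (Primrec.pair hM (Primrec.pair hu Primrec.snd))
  have h2 : Primrec fun x : (List (List ℕ) × ℕ) × ℕ => entry x.1.1 x.2 x.1.2 :=
    primrec_entry.comp (Primrec.pair hM (Primrec.pair Primrec.snd hu))
  exact Primrec.ite (primrecPred_eq h1 (Primrec.const 0)) (Primrec.const [])
    (Primrec.list_cons.comp (Primrec.pair (Primrec.pair hu h1) (Primrec.pair Primrec.snd h2))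
      (Primrec.const []))

theorem primrecPred_isPortMatrix : PrimrecPred IsPortMatrix := by
  let X := List (List ℕ)
  have hl : Primrec fun M : X => M.length := Primrec.list_length
  refine PrimrecPred.and (primrecPred_forall_mem (f := fun M : X => M)
    (R := fun (M : X) r => r.length = M.length) Primrec.id (primrecPred_eq (Primrec.list_length.comp Primrec.snd) (hl.comp Primrec.fst)))
    (PrimrecPred.and ?_ (primrecPred_dartsConnected.comp (Primrec.pair hl primrec_matrixDarts)))
  refine primrecPred_forall_lt (R := fun (M : X) u => entry M u u = 0 ∧ ∀ v < M.length,
    entry M u v ≠ 0 → entry M v u ≠ 0 ∧ (∀ w < M.length, entry M u v = entry M u w → v = w) ∧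
    (∀ k < entry M u v, k ≠ 0 → ∃ w < M.length, entry M u w = k)) hl (PrimrecPred.and ?_
    (primrecPred_forall_lt (R := fun (x : X × ℕ) v => entry x.1 x.2 v ≠ 0 → entry x.1 v x.2 ≠ 0 ∧
      (∀ w < x.1.length, entry x.1 x.2 v = entry x.1 x.2 w → v = w) ∧
      (∀ k < entry x.1 x.2 v, k ≠ 0 → ∃ w < x.1.length, entry x.1 x.2 w = k))
      (hl.comp Primrec.fst) ?_))
  · exact primrecPred_eq (primrec_entry.comp (Primrec.pair Primrec.fst
      (Primrec.pair Primrec.snd Primrec.snd))) (Primrec.const 0)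
  have hM : Primrec fun x : (X × ℕ) × ℕ => x.1.1 := Primrec.fst.comp Primrec.fst
  have hu : Primrec fun x : (X × ℕ) × ℕ => x.1.2 := Primrec.snd.comp Primrec.fst
  have huv : Primrec fun x : (X × ℕ) × ℕ => entry x.1.1 x.1.2 x.2 :=
    primrec_entry.comp (Primrec.pair hM (Primrec.pair hu Primrec.snd))
  have hvu : Primrec fun x : (X × ℕ) × ℕ => entry x.1.1 x.2 x.1.2 :=
    primrec_entry.comp (Primrec.pair hM (Primrec.pair Primrec.snd hu))
  refine primrecPred_imp (primrecPred_eq huv (Primrec.const 0)).not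
    ((primrecPred_eq hvu (Primrec.const 0)).not.and (PrimrecPred.and
      (primrecPred_forall_lt (R := fun (x : (X × ℕ) × ℕ) w =>
        entry x.1.1 x.1.2 x.2 = entry x.1.1 x.1.2 w → x.2 = w) (hl.comp hM) ?_)
      (primrecPred_forall_lt (R := fun (x : (X × ℕ) × ℕ) k =>
        k ≠ 0 → ∃ w < x.1.1.length, entry x.1.1 x.1.2 w = k) huv ?_)))
  · refine primrecPred_imp (primrecPred_eq (huv.comp Primrec.fst) ?_)
      (primrecPred_eq (Primrec.snd.comp Primrec.fst) Primrec.snd)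
    exact primrec_entry.comp (Primrec.pair (hM.comp Primrec.fst)
      (Primrec.pair (hu.comp Primrec.fst) Primrec.snd))
  · refine primrecPred_imp (primrecPred_eq Primrec.snd (Primrec.const 0)).not
      (primrecPred_exists_lt (R := fun (x : ((X × ℕ) × ℕ) × ℕ) w =>
        entry x.1.1.1 x.1.1.2 w = x.2) (hl.comp (hM.comp Primrec.fst)) ?_)
    refine primrecPred_eq ?_ (Primrec.snd.comp Primrec.fst)
    exact primrec_entry.comp (Primrec.pair (hM.comp (Primrec.fst.comp Primrec.fst))
      (Primrec.pair (hu.comp (Primrec.fst.comp Primrec.fst)) Primrec.snd))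

theorem mem_matrixDarts {M : List (List ℕ)} {u p v q : ℕ} :
    ((u, p), (v, q)) ∈ matrixDarts M ↔ u < M.length ∧ v < M.length ∧ entry M u v ≠ 0 ∧
      p = entry M u v ∧ q = entry M v u := by
  simp only [matrixDarts, List.mem_flatMap, List.mem_range]
  constructor
  · rintro ⟨u', hu, v', hv, h⟩
    split_ifs at h with h0
    · simp at h
    · simp only [List.mem_singleton, Prod.mk.injEq] at h
      obtain ⟨⟨rfl, rfl⟩, rfl, rfl⟩ := h
      exact ⟨hu, hv, h0, rfl, rfl⟩
  · rintro ⟨hu, hv, h, rfl, rfl⟩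
    exact ⟨u, hu, v, hv, by simp [h]⟩

namespace PortGraph

variable (G : PortGraph)

theorem length_matrix : G.matrix.length = G.size := by simp [matrix]

theorem entry_matrix (u v : Fin G.size) : entry G.matrix u v = G.port u v := by
  simp [entry, matrix, List.getD]

theorem mem_matrixDarts_matrix {u v p q : ℕ} : ((u, p), (v, q)) ∈ matrixDarts G.matrix ↔
    ∃ (hu : u < G.size) (hv : v < G.size), G.graph.Adj ⟨u, hu⟩ ⟨v, hv⟩ ∧
      p = G.port ⟨u, hu⟩ ⟨v, hv⟩ ∧ q = G.port ⟨v, hv⟩ ⟨u, hu⟩ := by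
  rw [mem_matrixDarts, length_matrix]
  constructor
  · rintro ⟨hu, hv, h0, hp, hq⟩
    have h1 := G.entry_matrix ⟨u, hu⟩ ⟨v, hv⟩
    have h2 := G.entry_matrix ⟨v, hv⟩ ⟨u, hu⟩
    simp only at h1 h2
    refine ⟨hu, hv, ?_, hp.trans h1, hq.trans h2⟩
    rwa [← port_ne_zero_iff, ← h1]
  · rintro ⟨hu, hv, ha, hp, hq⟩
    have h1 := G.entry_matrix ⟨u, hu⟩ ⟨v, hv⟩
    have h2 := G.entry_matrix ⟨v, hv⟩ ⟨u, hu⟩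
    simp only at h1 h2
    refine ⟨hu, hv, ?_, hp.trans h1.symm, hq.trans h2.symm⟩
    rwa [h1, port_ne_zero_iff]

theorem lt_of_mem_matrixDarts : ∀ d ∈ matrixDarts G.matrix, d.1.1 < G.size ∧ d.2.1 < G.size := by
  rintro ⟨⟨u, p⟩, ⟨v, q⟩⟩ h
  obtain ⟨hu, hv, -⟩ := G.mem_matrixDarts_matrix.1 h
  exact ⟨hu, hv⟩

theorem functional_matrixDarts : DartsFunctional (matrixDarts G.matrix) := by
  rintro ⟨⟨u, p⟩, ⟨v, q⟩⟩ h ⟨⟨u', p'⟩, ⟨v', q'⟩⟩ h' he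
  obtain ⟨hu, hv, ha, hp, hq⟩ := G.mem_matrixDarts_matrix.1 h
  obtain ⟨hu', hv', ha', hp', hq'⟩ := G.mem_matrixDarts_matrix.1 h'
  simp only [Prod.mk.injEq] at he
  obtain ⟨rfl, rfl⟩ := he
  have := port_inj ha (hp.symm.trans hp')
  simp only [Fin.mk.injEq] at this
  subst this
  simp [hq, hq']

/-- Replaces walks in `G` by walks between natural numbers, whose histories are primitive recursive
in the matrix. -/
theorem indist_matrixDarts (u : Fin G.size) :
    Indist G.go (dartStep (matrixDarts G.matrix)) u u.val := by
  refine indist_of_bisim (fun (u : Fin G.size) v => u.val = v) ?_ rfl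
  rintro u _ p rfl
  cases h : (G.go u p).2 with
  | some q =>
    obtain ⟨h1, h2, h3⟩ := adj_of_go h
    rw [dartStep_of_mem G.functional_matrixDarts (G.mem_matrixDarts_matrix.2
      ⟨u.2, (G.go u p).1.2, h1, h2.symm, h3.symm⟩)]
    simp
  | none =>
    cases h' : (dartStep (matrixDarts G.matrix) u p).2 with
    | some q =>
      obtain ⟨hu, hv, ha, hp, hq⟩ := G.mem_matrixDarts_matrix.1 (mem_of_dartStep h')
      rw [hp] at h
      have := go_of_adj ha
      simp only [Fin.eta] at this h
      rw [this] at h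
      simp at h
    | none =>
      have h2 : (dartStep (matrixDarts G.matrix) u p).1 = u := by
        unfold dartStep at h' ⊢
        cases he : firstValue (matrixDarts G.matrix) (u.val, p) with
        | none => simp
        | some e => simp [he] at h'
      rw [h2, reversible_go.stay _ _ h]
      simp

end PortGraph

/-- Allows `IsPortMatrix` to ask only that there be no gap below a port in use, without mentioning
the degree. -/
theorem eq_Icc_of_downward_closed {T : Set ℕ} (hT : T.Finite) (h0 : 0 ∉ T)
    (h : ∀ n ∈ T, ∀ k < n, k ≠ 0 → k ∈ T) : T = Set.Icc 1 T.ncard := by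
  rcases T.eq_empty_or_nonempty with rfl | hne
  · simp
  · obtain ⟨m, hm, hmax⟩ := hT.exists_maximal hne
    have : T = Set.Icc 1 m := by
      ext k
      constructor
      · intro hk
        refine ⟨Nat.one_le_iff_ne_zero.2 fun h' => h0 (h' ▸ hk), ?_⟩
        by_contra h'
        exact h' (hmax hk (le_of_not_ge h'))
      · rintro ⟨h1, h2⟩
        rcases h2.lt_or_eq with h2 | rfl
        · exact h m hm k h2 (by omega)
        · exact hm
    have hc : T.ncard = m := by rw [this]; simp
    rw [hc]
    exact this

/-- The graph that is described by a matrix of port numbers. -/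
def PortGraph.ofMatrix (M : List (List ℕ)) (h : IsPortMatrix M) : PortGraph where
  size := M.length
  graph :=
    { Adj := fun u v => entry M u v ≠ 0
      symm := ⟨fun u v huv => ((h.2.1 u u.2).2 v v.2 huv).1⟩
      loopless := ⟨fun u hu => hu (h.2.1 u u.2).1⟩ }
  connected := by
    refine (dartsConnected_iff ?_ ?_).1 h.2.2
    · intro u v huv
      exact ⟨_, _, mem_matrixDarts.2 ⟨u.2, v.2, huv, rfl, rfl⟩⟩
    · intro u p v q hd
      obtain ⟨hu, hv, h0, -⟩ := mem_matrixDarts.1 hd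
      exact ⟨hu, hv, fun _ => h0⟩
  port u v := entry M u v
  port_bijOn u := by
    set S : Set (Fin M.length) := {v | entry M u v ≠ 0} with hS
    have hinj : Set.InjOn (fun v : Fin M.length => entry M u v) S := fun v hv w _ hvw =>
      Fin.ext (((h.2.1 u u.2).2 v v.2 hv).2.1 w w.2 hvw)
    have : (fun v : Fin M.length => entry M u v) '' S = Set.Icc 1 S.ncard := by
      -- By injectivity the number of neighbors is the number of ports in use, so only the absence
      -- of gaps remains to be shown.
      rw [← hinj.ncard_image]
      refine eq_Icc_of_downward_closed (Set.toFinite _) ?_ ?_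
      · rintro ⟨v, hv, hv0⟩
        exact hv hv0
      · rintro _ ⟨v, hv, rfl⟩ k hk hk0
        obtain ⟨w, hw, rfl⟩ := ((h.2.1 u u.2).2 v v.2 hv).2.2 k hk hk0
        exact ⟨⟨w, hw⟩, hk0, rfl⟩
    exact this ▸ hinj.bijOn_image
  port_eq_zero u v huv := not_not.1 huv

theorem PortGraph.matrix_ofMatrix {M : List (List ℕ)} (h : IsPortMatrix M) :
    (PortGraph.ofMatrix M h).matrix = M := by
  refine List.ext_getElem (PortGraph.length_matrix _) fun u h1 h2 => ?_
  refine List.ext_getElem ?_ fun v h3 h4 => ?_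
  · rw [h.1 _ (List.getElem_mem h2)]
    simp [PortGraph.matrix, PortGraph.ofMatrix]
  · simp [PortGraph.matrix, PortGraph.ofMatrix, entry, List.getD, h4]

theorem PortGraph.isPortMatrix_matrix (G : PortGraph) : IsPortMatrix G.matrix := by
  refine ⟨?_, ?_, ?_⟩
  · intro r hr
    rw [length_matrix]
    simp only [matrix, List.mem_ofFn] at hr
    obtain ⟨u, rfl⟩ := hr
    simp
  · rw [length_matrix]
    intro u hu
    have he := G.entry_matrix ⟨u, hu⟩
    have he' := fun v => G.entry_matrix v ⟨u, hu⟩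
    simp only at he he'
    refine ⟨?_, ?_⟩
    · exact (he ⟨u, hu⟩).trans (G.port_eq_zero _ _ (SimpleGraph.irrefl _))
    · intro v hv h0
      have ha : G.graph.Adj ⟨u, hu⟩ ⟨v, hv⟩ := by
        rw [← port_ne_zero_iff, ← he]
        exact h0
      refine ⟨?_, ?_, ?_⟩
      · have := port_ne_zero ha.symm
        rwa [← he'] at this
      · intro w hw h
        have := port_inj (w := ⟨w, hw⟩) ha (by rw [← he, ← he]; exact h)
        simpa using this
      · intro k hk hk0
        have h1 := ((G.port_bijOn ⟨u, hu⟩).mapsTo (x := ⟨v, hv⟩) ha).2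
        rw [← he] at h1
        simp only at h1
        obtain ⟨w, -, hw⟩ := (G.port_bijOn ⟨u, hu⟩).surjOn (a := k) ⟨by omega, by omega⟩
        exact ⟨w, w.2, by rw [he, hw]⟩
  · rw [length_matrix]
    refine (dartsConnected_iff ?_ ?_).2 G.connected
    · intro u v ha
      exact ⟨_, _, G.mem_matrixDarts_matrix.2 ⟨u.2, v.2, ha, rfl, rfl⟩⟩
    · intro u p v q hd
      obtain ⟨hu, hv, ha, -⟩ := G.mem_matrixDarts_matrix.1 hd
      exact ⟨hu, hv, fun _ => ha⟩

/-! ### Descriptions of given graphs -/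

/-- The number with the given binary digits, least significant first. -/
def bitsValue (q : List Bool) : ℕ := q.foldr Nat.bit 0

theorem primrec_bitsValue : Primrec bitsValue := by
  refine Primrec.list_foldr (h := fun _ x => Nat.bit x.1 x.2) Primrec.id (Primrec.const 0) ?_
  have : Primrec fun x : List Bool × Bool × ℕ => x.2.2 := Primrec.snd.comp Primrec.snd
  refine (Primrec.cond (Primrec.fst.comp Primrec.snd) (Primrec.nat_double_succ.comp this)
    (Primrec.nat_double.comp this)).of_eq ?_
  rintro ⟨_, b, n⟩
  cases b <;> rfl

theorem bitsValue_bits (n : ℕ) : bitsValue n.bits = n := by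
  induction n using Nat.binaryRec' with
  | zero => rfl
  | bit b n h ih =>
    rw [Nat.bits_append_bit _ _ h, bitsValue, List.foldr_cons]
    exact congrArg _ ih

/-- The most significant digit comes last, so a final `false` is the only way in which a string
fails to be canonical. -/
theorem bits_bitsValue {q : List Bool} (h : q.getLast? ≠ some false) : (bitsValue q).bits = q := by
  induction q with
  | nil => rfl
  | cons b q ih =>
    have hq : q.getLast? ≠ some false := by
      cases q with
      | nil => simp
      | cons c q => simpa [List.getLast?_cons_cons] using h
    change (Nat.bit b (bitsValue q)).bits = _
    rw [Nat.bits_append_bit, ih hq]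
    intro h0
    have : q = [] := by rw [← ih hq, h0]; rfl
    subst this
    simpa using h

theorem getLast?_bits (n : ℕ) : n.bits.getLast? ≠ some false := by
  induction n using Nat.binaryRec' with
  | zero => simp
  | bit b n h ih =>
    rw [Nat.bits_append_bit _ _ h]
    cases hb : n.bits with
    | nil =>
      have : n = 0 := by rw [← bitsValue_bits n, hb]; rfl
      simp [h this]
    | cons c l =>
      rw [List.getLast?_cons_cons, ← hb]
      exact ih

/-- The number of nodes and the list of edges that are described by a string. -/
def readGraph (q : List Bool) : ℕ × Darts := (Encodable.decode (bitsValue q)).getD (0, [])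

/-- The string is the description of a given graph. -/
def IsGraphCode (q : List Bool) : Prop :=
  q.getLast? ≠ some false ∧ Encodable.encode (readGraph q) = bitsValue q ∧
  (∀ d ∈ (readGraph q).2, (d.1.1 < (readGraph q).1 ∧ d.2.1 < (readGraph q).1) ∧
    0 < d.1.2 ∧ 0 < d.2.2) ∧
  DartsConnected (readGraph q).1 (bothWays (readGraph q).2)

theorem primrec_readGraph : Primrec readGraph :=
  Primrec.option_getD.comp (Primrec.decode.comp primrec_bitsValue) (Primrec.const _)

theorem primrecPred_isGraphCode : PrimrecPred IsGraphCode := by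
  have h1 : Primrec fun q => (readGraph q).1 := Primrec.fst.comp primrec_readGraph
  have h2 : Primrec fun q => (readGraph q).2 := Primrec.snd.comp primrec_readGraph
  refine PrimrecPred.and ?_ (PrimrecPred.and ?_ (PrimrecPred.and
    (primrecPred_forall_mem (R := fun q d => (d.1.1 < (readGraph q).1 ∧ d.2.1 < (readGraph q).1) ∧
    0 < d.1.2 ∧ 0 < d.2.2) h2 ?_)
    (primrecPred_dartsConnected.comp (Primrec.pair h1 (primrec_bothWays.comp h2)))))
  · exact ((primrecPred_eq (Primrec.list_head?.comp Primrec.list_reverse)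
      (Primrec.const (some false))).not).of_eq fun q => by simp
  · exact primrecPred_eq (Primrec.encode.comp primrec_readGraph) primrec_bitsValue
  · have ha : Primrec fun x : List Bool × ((ℕ × ℕ) × (ℕ × ℕ)) => x.2.1 :=
      Primrec.fst.comp Primrec.snd
    have hb : Primrec fun x : List Bool × ((ℕ × ℕ) × (ℕ × ℕ)) => x.2.2 :=
      Primrec.snd.comp Primrec.snd
    exact ((primrecPred_lt (Primrec.fst.comp ha) (h1.comp Primrec.fst)).and
      (primrecPred_lt (Primrec.fst.comp hb) (h1.comp Primrec.fst))).and
      ((primrecPred_lt (Primrec.const 0) (Primrec.snd.comp ha)).and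
      (primrecPred_lt (Primrec.const 0) (Primrec.snd.comp hb)))

namespace GivenGraph

/-- Forget that the nodes are less than `n`. -/
def rawDart {n : ℕ} (d : (Fin n × ℕ) × (Fin n × ℕ)) : (ℕ × ℕ) × (ℕ × ℕ) :=
  ((d.1.1.val, d.1.2), (d.2.1.val, d.2.2))

theorem readGraph_code (H : GivenGraph) :
    readGraph H.code = (H.size, H.edgeList.map rawDart) := by
  unfold readGraph code
  rw [bitsValue_bits, Encodable.encodek]
  rfl

variable (H : GivenGraph)

theorem rawDart_mem_iff {n : ℕ} {L : List ((Fin n × ℕ) × (Fin n × ℕ))}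
    {d : (Fin n × ℕ) × (Fin n × ℕ)} : rawDart d ∈ L.map rawDart ↔ d ∈ L := by
  refine List.mem_map_of_injective ?_
  rintro ⟨⟨x, p⟩, ⟨y, q⟩⟩ ⟨⟨x', p'⟩, ⟨y', q'⟩⟩ h
  simp only [rawDart, Prod.mk.injEq, Fin.val_inj] at h
  simpa using h

theorem bothWays_map_rawDart {n : ℕ} (L : List ((Fin n × ℕ) × (Fin n × ℕ))) :
    bothWays (L.map rawDart) = (bothWays L).map rawDart := by
  simp only [bothWays, List.map_append, List.map_map]
  rfl

/-- The darts between natural numbers that are read off from the description. -/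
theorem bothWays_readGraph_code :
    bothWays (readGraph H.code).2 = H.darts.map rawDart := by
  rw [readGraph_code, bothWays_map_rawDart]
  rfl

theorem functional_map_rawDart :
    DartsFunctional (H.darts.map rawDart) ↔ DartsFunctional H.darts := by
  constructor
  · rintro h ⟨⟨x, p⟩, ⟨y, q⟩⟩ hd ⟨⟨x', p'⟩, ⟨y', q'⟩⟩ he hde
    have := h _ (rawDart_mem_iff.2 hd) _ (rawDart_mem_iff.2 he)
    simp only [rawDart, Prod.mk.injEq, Fin.val_inj] at this hde ⊢
    exact this hde
  · intro h d hd e he hde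
    obtain ⟨⟨⟨x, p⟩, ⟨y, q⟩⟩, hd', rfl⟩ := List.mem_map.1 hd
    obtain ⟨⟨⟨x', p'⟩, ⟨y', q'⟩⟩, he', rfl⟩ := List.mem_map.1 he
    have := h _ hd' _ he'
    simp only [rawDart, Prod.mk.injEq, Fin.val_inj] at this hde ⊢
    exact this hde

theorem lt_of_mem_map_rawDart :
    ∀ d ∈ H.darts.map rawDart, d.1.1 < H.size ∧ d.2.1 < H.size := by
  intro d hd
  obtain ⟨d, -, rfl⟩ := List.mem_map.1 hd
  exact ⟨d.1.1.2, d.2.1.2⟩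

theorem indist_rawDart (hD : DartsFunctional H.darts) (x : Fin H.size) :
    Indist (dartStep H.darts) (dartStep (H.darts.map rawDart)) x x.val := by
  refine indist_of_bisim (fun (u : Fin H.size) v => u.val = v) ?_ rfl
  rintro x _ p rfl
  have hD' := H.functional_map_rawDart.2 hD
  have hs : ∀ d ∈ H.darts.map rawDart, d.swap ∈ H.darts.map rawDart := by
    intro d hd
    obtain ⟨e, he, rfl⟩ := List.mem_map.1 hd
    exact List.mem_map.2 ⟨e.swap, swap_mem_bothWays e he, rfl⟩
  cases h : (dartStep H.darts x p).2 with
  | some q =>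
    rw [dartStep_of_mem hD' (rawDart_mem_iff.2 (mem_of_dartStep h))]
    simp
  | none =>
    cases h' : (dartStep (H.darts.map rawDart) x p).2 with
    | some q =>
      obtain ⟨⟨⟨x', p'⟩, ⟨y', q'⟩⟩, hd, he⟩ := List.mem_map.1 (mem_of_dartStep h')
      simp only [rawDart, Prod.mk.injEq, Fin.val_inj] at he
      obtain ⟨⟨rfl, rfl⟩, -⟩ := he
      rw [dartStep_of_mem hD hd] at h
      simp at h
    | none =>
      rw [(reversible_dartStep hD' hs).stay _ _ h',
        (reversible_dartStep hD swap_mem_bothWays).stay _ _ h]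
      simp

end GivenGraph

theorem dartsConnected_bothWays_iff {n : ℕ} (L : List ((Fin n × ℕ) × (Fin n × ℕ))) :
    DartsConnected n (bothWays (L.map GivenGraph.rawDart)) ↔
      (PortMultigraph.ofList L).Connected := by
  rw [GivenGraph.bothWays_map_rawDart]
  have hmem : ∀ a b, s(a, b) ∈ (PortMultigraph.ofList L).edges ↔ (a, b) ∈ bothWays L :=
    fun a b => mem_bothWays.symm
  refine dartsConnected_iff ?_ ?_
  · intro u v h
    rw [SimpleGraph.fromRel_adj] at h
    obtain ⟨-, ⟨p, q, h⟩ | ⟨p, q, h⟩⟩ := h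
    · exact ⟨p, q, GivenGraph.rawDart_mem_iff (d := ((u, p), (v, q))).2 ((hmem _ _).1 h)⟩
    · rw [Sym2.eq_swap] at h
      exact ⟨q, p, GivenGraph.rawDart_mem_iff (d := ((u, q), (v, p))).2 ((hmem _ _).1 h)⟩
  · intro u p v q h
    obtain ⟨⟨⟨x, p'⟩, ⟨y, q'⟩⟩, hd, he⟩ := List.mem_map.1 h
    simp only [GivenGraph.rawDart, Prod.mk.injEq] at he
    obtain ⟨⟨rfl, rfl⟩, rfl, rfl⟩ := he
    refine ⟨x.2, y.2, fun hne => ?_⟩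
    rw [SimpleGraph.fromRel_adj]
    exact ⟨fun h => hne (congrArg Fin.val h), .inl ⟨_, _, (hmem _ _).2 hd⟩⟩

/-- The first two conditions in `IsGraphCode` make the string canonical: it has no superfluous
digit, and its number is the code of the pair read from it, which also rules out that `readGraph`
has fallen back on its default. The other two are the requirements on a given graph. -/
theorem isGraphCode_iff {q : List Bool} : IsGraphCode q ↔ ∃ H : GivenGraph, q = H.code := by
  constructor
  · rintro ⟨h1, h2, h3, h4⟩
    obtain ⟨⟨n, L⟩, hq⟩ : ∃ r, readGraph q = r := ⟨_, rfl⟩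
    rw [hq] at h2 h3 h4
    simp only at h2 h3 h4
    let L' : List ((Fin n × ℕ) × (Fin n × ℕ)) := L.pmap
      (fun d hd => ((⟨d.1.1, hd.1⟩, d.1.2), (⟨d.2.1, hd.2⟩, d.2.2))) fun d hd => (h3 d hd).1
    have hL : L'.map GivenGraph.rawDart = L := by
      simp only [L', List.map_pmap]
      exact (List.pmap_eq_map ..).trans (List.map_id L)
    refine ⟨⟨n, L', ?_, ?_⟩, ?_⟩
    · intro d hd
      have := h3 (GivenGraph.rawDart d) (hL ▸ List.mem_map_of_mem hd)
      exact this.2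
    · rw [← dartsConnected_bothWays_iff, hL]
      exact h4
    · rw [← bits_bitsValue h1, ← h2]
      exact (congrArg (fun x : Darts => (Encodable.encode (n, x)).bits) hL).symm
  · rintro ⟨H, rfl⟩
    refine ⟨getLast?_bits _, ?_, ?_, ?_⟩
    · rw [GivenGraph.readGraph_code]
      exact (bitsValue_bits _).symm
    · rw [GivenGraph.readGraph_code]
      intro d hd
      obtain ⟨e, he, rfl⟩ := List.mem_map.1 hd
      exact ⟨⟨e.1.1.2, e.2.1.2⟩, H.label_pos e he⟩
    · rw [GivenGraph.readGraph_code]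
      exact (dartsConnected_bothWays_iff _).2 H.connected

/-! ### Evidence for and against being the quotient graph -/

/-- Evidence that the graph described by `q` is not the quotient graph: some port is used twice at
a node of it, or the coloring `c` shows that no walk distinguishes two of its nodes, or the walk
`σ`, on which an agent has recorded the history `τ`, yields another history from all of its
nodes. -/
def Refutes (q : List Bool) (τ : List (Option ℕ)) (σ c : List ℕ) : Prop :=
  ¬ DartsFunctional (bothWays (readGraph q).2) ∨
  (Imitates (readGraph q).1 (bothWays (readGraph q).2) (bothWays (readGraph q).2) c c ∧
    ∃ x < (readGraph q).1, ∃ y < (readGraph q).1, x ≠ y ∧ c.getD x 0 = c.getD y 0) ∨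
  ∀ x < (readGraph q).1, history (dartStep (bothWays (readGraph q).2)) x σ ≠ τ

/-- Evidence that the graph described by `q` is the quotient graph of the one with the matrix `M`:
the walk `σ` distinguishes all nodes of the former, and the colorings `c` and `c'` of the nodes of
the two graphs are compatible with the darts. -/
def Confirms (M : List (List ℕ)) (q : List Bool) (σ c c' : List ℕ) : Prop :=
  DartsFunctional (bothWays (readGraph q).2) ∧
  (∀ x < (readGraph q).1, ∀ y < (readGraph q).1, history (dartStep (bothWays (readGraph q).2)) x σ =
    history (dartStep (bothWays (readGraph q).2)) y σ → x = y) ∧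
  Imitates (readGraph q).1 (matrixDarts M) (bothWays (readGraph q).2) c c' ∧
  Imitates M.length (bothWays (readGraph q).2) (matrixDarts M) c' c ∧
  ∃ u < M.length, ∃ x < (readGraph q).1, c.getD u 0 = c'.getD x 0

theorem primrec_darts_readGraph : Primrec fun q => bothWays (readGraph q).2 :=
  primrec_bothWays.comp (Primrec.snd.comp primrec_readGraph)

theorem primrec_size_readGraph : Primrec fun q => (readGraph q).1 :=
  Primrec.fst.comp primrec_readGraph

theorem primrecPred_refutes : PrimrecPred
    fun x : List Bool × List (Option ℕ) × List ℕ × List ℕ =>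
      Refutes x.1 x.2.1 x.2.2.1 x.2.2.2 := by
  let X := List Bool × List (Option ℕ) × List ℕ × List ℕ
  have hD : Primrec fun x : X => bothWays (readGraph x.1).2 :=
    primrec_darts_readGraph.comp Primrec.fst
  have hn : Primrec fun x : X => (readGraph x.1).1 := primrec_size_readGraph.comp Primrec.fst
  have hτ : Primrec fun x : X => x.2.1 := Primrec.fst.comp Primrec.snd
  have hσ : Primrec fun x : X => x.2.2.1 := Primrec.fst.comp (Primrec.snd.comp Primrec.snd)
  have hc : Primrec fun x : X => x.2.2.2 := Primrec.snd.comp (Primrec.snd.comp Primrec.snd)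
  refine (primrecPred_dartsFunctional.comp hD).not.or (PrimrecPred.or (PrimrecPred.and
    (primrecPred_imitates.comp (Primrec.pair hn (Primrec.pair hD (Primrec.pair hD
      (Primrec.pair hc hc)))))
    (primrecPred_exists_lt (R := fun (x : X) u => ∃ y < (readGraph x.1).1, u ≠ y ∧
      x.2.2.2.getD u 0 = x.2.2.2.getD y 0) hn
      (primrecPred_exists_lt (R := fun (x : X × ℕ) y => x.2 ≠ y ∧
        x.1.2.2.2.getD x.2 0 = x.1.2.2.2.getD y 0) (hn.comp Primrec.fst) ?_)))
    (primrecPred_forall_lt (R := fun (x : X) u =>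
      history (dartStep (bothWays (readGraph x.1).2)) u x.2.2.1 ≠ x.2.1) hn ?_))
  · have h1 : Primrec fun y : (X × ℕ) × ℕ => y.1.2 := Primrec.snd.comp Primrec.fst
    have h2 : Primrec fun y : (X × ℕ) × ℕ => y.1.1.2.2.2 := hc.comp (Primrec.fst.comp Primrec.fst)
    exact (primrecPred_eq h1 Primrec.snd).not.and
      (primrecPred_eq ((Primrec.list_getD 0).comp h2 h1) ((Primrec.list_getD 0).comp h2 Primrec.snd))
  · have h1 : Primrec fun y : X × ℕ => (bothWays (readGraph y.1.1).2, y.2, y.1.2.2.1) :=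
      Primrec.pair (hD.comp Primrec.fst) (Primrec.pair Primrec.snd (hσ.comp Primrec.fst))
    exact (primrecPred_eq (primrec_history.comp h1) (hτ.comp Primrec.fst)).not

theorem primrecPred_confirms : PrimrecPred
    fun x : List (List ℕ) × List Bool × List ℕ × List ℕ × List ℕ =>
      Confirms x.1 x.2.1 x.2.2.1 x.2.2.2.1 x.2.2.2.2 := by
  let X := List (List ℕ) × List Bool × List ℕ × List ℕ × List ℕ
  have hM : Primrec fun x : X => x.1 := Primrec.fst
  have hN : Primrec fun x : X => x.1.length := Primrec.list_length.comp hM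
  have hE : Primrec fun x : X => matrixDarts x.1 := primrec_matrixDarts.comp hM
  have hq : Primrec fun x : X => x.2.1 := Primrec.fst.comp Primrec.snd
  have hD : Primrec fun x : X => bothWays (readGraph x.2.1).2 := primrec_darts_readGraph.comp hq
  have hn : Primrec fun x : X => (readGraph x.2.1).1 := primrec_size_readGraph.comp hq
  have hσ : Primrec fun x : X => x.2.2.1 := Primrec.fst.comp (Primrec.snd.comp Primrec.snd)
  have hc : Primrec fun x : X => x.2.2.2.1 :=
    Primrec.fst.comp (Primrec.snd.comp (Primrec.snd.comp Primrec.snd))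
  have hc' : Primrec fun x : X => x.2.2.2.2 :=
    Primrec.snd.comp (Primrec.snd.comp (Primrec.snd.comp Primrec.snd))
  refine (primrecPred_dartsFunctional.comp hD).and (PrimrecPred.and
    (primrecPred_forall_lt (R := fun (x : X) u => ∀ y < (readGraph x.2.1).1,
      history (dartStep (bothWays (readGraph x.2.1).2)) u x.2.2.1 =
        history (dartStep (bothWays (readGraph x.2.1).2)) y x.2.2.1 → u = y) hn
      (primrecPred_forall_lt (R := fun (x : X × ℕ) y =>
        history (dartStep (bothWays (readGraph x.1.2.1).2)) x.2 x.1.2.2.1 =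
        history (dartStep (bothWays (readGraph x.1.2.1).2)) y x.1.2.2.1 → x.2 = y)
        (hn.comp Primrec.fst) ?_))
    (PrimrecPred.and
      (primrecPred_imitates.comp (Primrec.pair hn (Primrec.pair hE (Primrec.pair hD
        (Primrec.pair hc hc'))))) (PrimrecPred.and
      (primrecPred_imitates.comp (Primrec.pair hN (Primrec.pair hD (Primrec.pair hE
        (Primrec.pair hc' hc)))))
      (primrecPred_exists_lt (R := fun (x : X) u => ∃ y < (readGraph x.2.1).1,
        x.2.2.2.1.getD u 0 = x.2.2.2.2.getD y 0) hN
        (primrecPred_exists_lt (R := fun (x : X × ℕ) y =>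
          x.1.2.2.2.1.getD x.2 0 = x.1.2.2.2.2.getD y 0) (hn.comp Primrec.fst) ?_)))))
  · have h0 : Primrec fun y : (X × ℕ) × ℕ => y.1.1 := Primrec.fst.comp Primrec.fst
    have h1 : Primrec fun y : (X × ℕ) × ℕ => y.1.2 := Primrec.snd.comp Primrec.fst
    have h2 : Primrec fun y : (X × ℕ) × ℕ =>
        (bothWays (readGraph y.1.1.2.1).2, y.1.2, y.1.1.2.2.1) :=
      Primrec.pair (hD.comp h0) (Primrec.pair h1 (hσ.comp h0))
    have h3 : Primrec fun y : (X × ℕ) × ℕ =>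
        (bothWays (readGraph y.1.1.2.1).2, y.2, y.1.1.2.2.1) :=
      Primrec.pair (hD.comp h0) (Primrec.pair Primrec.snd (hσ.comp h0))
    exact primrecPred_imp (primrecPred_eq (primrec_history.comp h2) (primrec_history.comp h3))
      (primrecPred_eq h1 Primrec.snd)
  · have h0 : Primrec fun y : (X × ℕ) × ℕ => y.1.1 := Primrec.fst.comp Primrec.fst
    have h1 : Primrec fun y : (X × ℕ) × ℕ => y.1.2 := Primrec.snd.comp Primrec.fst
    exact primrecPred_eq ((Primrec.list_getD 0).comp (hc.comp h0) h1)
      ((Primrec.list_getD 0).comp (hc'.comp h0) Primrec.snd)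

theorem getD_ofFn {n : ℕ} (f : Fin n → ℕ) (x : Fin n) : (List.ofFn f).getD x 0 = f x := by
  simp [List.getD]

/-! ### Soundness and completeness of the evidence -/

section Evidence

variable {G : PortGraph} {H : GivenGraph}

/-- The three clauses of `Refutes` contradict the three conditions in `isIsomorphic_iff`; in the
last one, the node of `H` that is indistinguishable from `s` reproduces the recorded history. -/
theorem not_refutes (hiso : G.quotient.IsIsomorphic H.toMultigraph) (s : Fin G.size)
    (σ c : List ℕ) : ¬ Refutes H.code (history G.go s σ) σ c := by
  obtain ⟨hD, hH, h, hs⟩ := (isIsomorphic_iff s).1 hiso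
  have hD' := H.functional_map_rawDart.2 hD
  unfold Refutes
  rw [H.bothWays_readGraph_code, H.readGraph_code]
  rintro (hn | ⟨hi, x, hx, y, hy, hne, hc⟩ | hn)
  · exact hn hD'
  · have hlt : ∀ d ∈ H.darts.map GivenGraph.rawDart, d.2.1 < H.size := fun d hd =>
      (H.lt_of_mem_map_rawDart d hd).2
    have := indist_of_imitates hD' hD' hlt hlt hi hi hx hy hc
    have := hH ⟨x, hx⟩ ⟨y, hy⟩ (((H.indist_rawDart hD ⟨x, hx⟩).trans this).trans
      (H.indist_rawDart hD ⟨y, hy⟩).symm)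
    exact hne (congrArg Fin.val this)
  · exact hn h h.2 ((hs.trans (H.indist_rawDart hD h)).symm σ)

/-- Each condition of `isIsomorphic_iff` that fails provides one clause, and the components of the
evidence that this clause does not use are left empty. -/
theorem exists_refutes (hiso : ¬ G.quotient.IsIsomorphic H.toMultigraph) (s : Fin G.size) :
    ∃ σ c, Refutes H.code (history G.go s σ) σ c := by
  rw [isIsomorphic_iff s] at hiso
  unfold Refutes
  rw [H.bothWays_readGraph_code, H.readGraph_code]
  by_cases hD : DartsFunctional H.darts
  swap
  · exact ⟨[], [], .inl (H.functional_map_rawDart.not.2 hD)⟩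
  have hD' := H.functional_map_rawDart.2 hD
  by_cases hH : ∀ x y, Indist (dartStep H.darts) (dartStep H.darts) x y → x = y
  · have hh : ∀ h, ¬ Indist G.go (dartStep H.darts) s h := fun h hh => hiso ⟨hD, hH, h, hh⟩
    obtain ⟨σ, hσ⟩ := exists_separating_walk PortGraph.reversible_go
      (reversible_dartStep hD swap_mem_bothWays) ({s} ×ˢ Set.univ) (Set.toFinite _) (by
        rintro ⟨s', h⟩ ⟨rfl, -⟩
        exact hh h)
    refine ⟨σ, [], .inr (.inr fun x hx he => ?_)⟩
    exact hσ (s, ⟨x, hx⟩) ⟨rfl, trivial⟩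
      (he.symm.trans ((H.indist_rawDart hD ⟨x, hx⟩).symm σ))
  · push Not at hH
    obtain ⟨x, y, hxy, hne⟩ := hH
    let S : Setoid (Fin H.size) := ⟨fun x y => Indist (dartStep H.darts) (dartStep H.darts) x y,
      Indist.refl, Indist.symm, Indist.trans⟩
    -- The color of a node is the number of a representative chosen in its class of
    -- indistinguishable nodes.
    let f : Fin H.size → ℕ := fun x => (Quotient.mk S x).out.val
    have hf : ∀ x y, f x = f y ↔ Indist (dartStep H.darts) (dartStep H.darts) x y := by
      intro x y
      simp only [f, Fin.val_inj, Quotient.out_inj]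
      exact Quotient.eq
    refine ⟨[], List.ofFn f, .inr (.inl ⟨?_, x, x.2, y, y.2, fun h => hne (Fin.ext h), ?_⟩)⟩
    · refine imitates_of_indist hD' H.lt_of_mem_map_rawDart
        (fun d hd => (H.lt_of_mem_map_rawDart d hd).2) ?_
      intro u hu v hv
      have h1 := getD_ofFn f ⟨u, hu⟩
      have h2 := getD_ofFn f ⟨v, hv⟩
      simp only at h1 h2
      rw [h1, h2, hf]
      have k1 := H.indist_rawDart hD ⟨u, hu⟩
      have k2 := H.indist_rawDart hD ⟨v, hv⟩
      exact ⟨fun h => (k1.symm.trans h).trans k2, fun h => (k1.trans h).trans k2.symm⟩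
    · rw [getD_ofFn, getD_ofFn, hf]
      exact hxy

/-- The two colorings form a bisimulation between `G` and `H`, so one pair of nodes of equal color
is indistinguishable, which is all that `isIsomorphic_iff` needs from `G`. That `σ` separates the
nodes of `H` is kept for locating the agent later. -/
theorem Confirms.isIsomorphic {σ c c' : List ℕ} (h : Confirms G.matrix H.code σ c c') :
    G.quotient.IsIsomorphic H.toMultigraph ∧ ∀ x y, history (dartStep H.darts) x σ =
      history (dartStep H.darts) y σ → x = y := by
  unfold Confirms at h
  rw [H.bothWays_readGraph_code, H.readGraph_code, G.length_matrix] at h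
  obtain ⟨hD', hσ, hi, hi', u, hu, x, hx, hc⟩ := h
  have hD := H.functional_map_rawDart.1 hD'
  have hσ' : ∀ x y, history (dartStep H.darts) x σ = history (dartStep H.darts) y σ → x = y := by
    intro x y h
    refine Fin.ext (hσ x x.2 y y.2 ?_)
    rw [← H.indist_rawDart hD x σ, ← H.indist_rawDart hD y σ, h]
  refine ⟨(isIsomorphic_iff ⟨u, hu⟩).2 ⟨hD, fun x y h => hσ' x y (h σ), ⟨x, hx⟩, ?_⟩, hσ'⟩
  have := indist_of_imitates G.functional_matrixDarts hD'
    (fun d hd => (G.lt_of_mem_matrixDarts d hd).2)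
    (fun d hd => (H.lt_of_mem_map_rawDart d hd).2) hi hi' hu hx hc
  exact ((G.indist_matrixDarts ⟨u, hu⟩).trans this).trans (H.indist_rawDart hD ⟨x, hx⟩).symm

/-- The colors come from a quotient map: a node of `H` is colored by its own number, a node of `G`
by the number of its image. The walk separates all pairs of distinct nodes of `H` at once. -/
theorem exists_confirms (hiso : G.quotient.IsIsomorphic H.toMultigraph) :
    ∃ σ c c', Confirms G.matrix H.code σ c c' := by
  unfold Confirms
  rw [H.bothWays_readGraph_code, H.readGraph_code, G.length_matrix]
  obtain ⟨f, hf⟩ := isIsomorphic_iff_exists_isQuotientMap.1 hiso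
  have hD := hf.functional
  have hD' := H.functional_map_rawDart.2 hD
  have hrev := reversible_dartStep hD swap_mem_bothWays
  obtain ⟨σ, hσ⟩ := exists_separating_walk hrev hrev {z | z.1 ≠ z.2} (Set.toFinite _)
    fun z hz h => hz (hf.eq_of_indist h)
  obtain ⟨s⟩ := G.connected.nonempty
  have hc : ∀ u < G.size, ∀ x < H.size, ((List.ofFn fun u => (f u).val).getD u 0 =
      (List.ofFn fun x : Fin H.size => x.val).getD x 0 ↔ Indist (dartStep (matrixDarts G.matrix))
        (dartStep (H.darts.map GivenGraph.rawDart)) u x) := by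
    intro u hu x hx
    have h1 := getD_ofFn (fun u => (f u).val) ⟨u, hu⟩
    have h2 := getD_ofFn (fun x : Fin H.size => x.val) ⟨x, hx⟩
    simp only at h1 h2
    rw [h1, h2]
    have k1 := G.indist_matrixDarts ⟨u, hu⟩
    have k2 := H.indist_rawDart hD ⟨x, hx⟩
    have k3 := hf.indist ⟨u, hu⟩
    constructor
    · intro h
      have : f ⟨u, hu⟩ = ⟨x, hx⟩ := Fin.ext h
      rw [this] at k3
      exact (k1.symm.trans k3).trans k2
    · intro h
      have := hf.eq_of_indist (k3.symm.trans ((k1.trans h).trans k2.symm))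
      exact congrArg Fin.val this
  refine ⟨σ, List.ofFn fun u => (f u).val, List.ofFn fun x : Fin H.size => x.val, hD', ?_, ?_, ?_,
    s, s.2, f s, (f s).2, ?_⟩
  · intro x hx y hy h
    by_contra hne
    refine hσ (⟨x, hx⟩, ⟨y, hy⟩) (fun h => hne (congrArg Fin.val h)) ?_
    rw [H.indist_rawDart hD ⟨x, hx⟩ σ, H.indist_rawDart hD ⟨y, hy⟩ σ]
    exact h
  · exact imitates_of_indist G.functional_matrixDarts G.lt_of_mem_matrixDarts
      (fun d hd => (H.lt_of_mem_map_rawDart d hd).2) hc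
  · exact imitates_of_indist hD' H.lt_of_mem_map_rawDart
      (fun d hd => (G.lt_of_mem_matrixDarts d hd).2)
      fun x hx u hu => ⟨fun h => ((hc u hu x hx).1 h.symm).symm,
        fun h => ((hc u hu x hx).2 h.symm).symm⟩
  · rw [getD_ofFn, getD_ofFn]

end Evidence

/-- Makes the graph in the definition of `quotientProblem` unique, so that non-membership yields an
isomorphism with the graph described. -/
theorem GivenGraph.code_injective : Function.Injective GivenGraph.code := by
  intro H K h
  have h' := congrArg readGraph h
  rw [readGraph_code, readGraph_code] at h'
  obtain ⟨n, L, _, _⟩ := H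
  obtain ⟨m, K, _, _⟩ := K
  simp only [Prod.mk.injEq] at h'
  obtain ⟨rfl, h2⟩ := h'
  have : Function.Injective (rawDart (n := n)) := by
    rintro ⟨⟨x, p⟩, ⟨y, q⟩⟩ ⟨⟨x', p'⟩, ⟨y', q'⟩⟩ h
    simp only [rawDart, Prod.mk.injEq, Fin.val_inj] at h
    simpa using h
  obtain rfl := this.list_map h2
  rfl

theorem mem_quotientProblem_iff {c : Config} {H : GivenGraph} (h : c.input = H.code) :
    c ∈ quotientProblem ↔ ¬ c.G.quotient.IsIsomorphic H.toMultigraph := by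
  constructor
  · rintro ⟨K, hK, hn⟩
    rwa [GivenGraph.code_injective (h.symm.trans hK)]
  · exact fun hn => ⟨H, h, hn⟩

/-! ### The problem `quotient` is decidable -/

/-- The object with the code `n`, or the default object if there is none. -/
def readNat (α : Type) [Primcodable α] [Inhabited α] (n : ℕ) : α :=
  (Encodable.decode n).getD default

theorem readNat_encode {α : Type} [Primcodable α] [Inhabited α] (a : α) :
    readNat α (Encodable.encode a) = a := by simp [readNat]

theorem primrec_readNat {α : Type} [Primcodable α] [Inhabited α] : Primrec (readNat α) :=
  Primrec.option_getD.comp Primrec.decode (Primrec.const _)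

theorem exists_computable_search {α : Type} [Primcodable α] {p : α → ℕ → Prop}
    (hp : PrimrecPred fun x : α × ℕ => p x.1 x.2) (h : ∀ a, ∃ n, p a n) :
    ∃ g : α → ℕ, Computable g ∧ ∀ a, p a (g a) := by
  classical
  refine ⟨fun a => Nat.find (h a), ?_, fun a => Nat.find_spec (h a)⟩
  have h1 : Computable₂ fun a n => decide (p a n) := hp.decide.to_comp
  refine (Partrec.rfind h1.partrec₂).of_eq_tot fun a => ?_
  rw [Nat.mem_rfind]
  refine ⟨?_, fun {m} hm => ?_⟩
  · have := Nat.find_spec (h a)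
    simpa using this
  · have := Nat.find_min (h a) hm
    simpa using this

/-- The list describes a configuration of the problem, apart from the identity. -/
def IsDescription (x : List (List ℕ) × ℕ × ℕ × List Bool) : Prop :=
  IsPortMatrix x.1 ∧ x.2.1 < x.1.length ∧ IsGraphCode x.2.2.2

/-- The number `n` encodes evidence against being the quotient graph. -/
def RefutedBy (x : List (List ℕ) × ℕ × ℕ × List Bool) (n : ℕ) : Prop :=
  Refutes x.2.2.2 (history (dartStep (matrixDarts x.1)) x.2.1 (readNat (List ℕ × List ℕ) n).1)
    (readNat (List ℕ × List ℕ) n).1 (readNat (List ℕ × List ℕ) n).2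

/-- The number `n` encodes evidence for being the quotient graph. -/
def ConfirmedBy (x : List (List ℕ) × ℕ × ℕ × List Bool) (n : ℕ) : Prop :=
  Confirms x.1 x.2.2.2 (readNat (List ℕ × List ℕ × List ℕ) n).1
    (readNat (List ℕ × List ℕ × List ℕ) n).2.1 (readNat (List ℕ × List ℕ × List ℕ) n).2.2

theorem primrecPred_isDescription : PrimrecPred IsDescription :=
  (primrecPred_isPortMatrix.comp Primrec.fst).and
    ((primrecPred_lt (Primrec.fst.comp Primrec.snd) (Primrec.list_length.comp Primrec.fst)).and
      (primrecPred_isGraphCode.comp (Primrec.snd.comp (Primrec.snd.comp Primrec.snd))))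

theorem primrecPred_refutedBy :
    PrimrecPred fun y : (List (List ℕ) × ℕ × ℕ × List Bool) × ℕ => RefutedBy y.1 y.2 := by
  let Y := (List (List ℕ) × ℕ × ℕ × List Bool) × ℕ
  have hq : Primrec fun y : Y => y.1.2.2.2 :=
    Primrec.snd.comp (Primrec.snd.comp (Primrec.snd.comp Primrec.fst))
  have hw : Primrec fun y : Y => readNat (List ℕ × List ℕ) y.2 := primrec_readNat.comp Primrec.snd
  have hτ : Primrec fun y : Y => history (dartStep (matrixDarts y.1.1)) y.1.2.1
      (readNat (List ℕ × List ℕ) y.2).1 :=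
    primrec_history.comp (Primrec.pair (primrec_matrixDarts.comp (Primrec.fst.comp Primrec.fst))
      (Primrec.pair (Primrec.fst.comp (Primrec.snd.comp Primrec.fst)) (Primrec.fst.comp hw)))
  have := primrecPred_refutes.comp (Primrec.pair hq (Primrec.pair hτ hw))
  exact this

theorem primrecPred_confirmedBy :
    PrimrecPred fun y : (List (List ℕ) × ℕ × ℕ × List Bool) × ℕ => ConfirmedBy y.1 y.2 := by
  let Y := (List (List ℕ) × ℕ × ℕ × List Bool) × ℕ
  have hq : Primrec fun y : Y => y.1.2.2.2 :=
    Primrec.snd.comp (Primrec.snd.comp (Primrec.snd.comp Primrec.fst))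
  have hw : Primrec fun y : Y => readNat (List ℕ × List ℕ × List ℕ) y.2 :=
    primrec_readNat.comp Primrec.snd
  have := primrecPred_confirms.comp
    (Primrec.pair (Primrec.fst.comp (Primrec.fst (α := List (List ℕ) × ℕ × ℕ × List Bool) (β := ℕ)))
      (Primrec.pair hq hw))
  exact this

theorem refutedBy_code {c : Config} {n : ℕ} : RefutedBy c.code n ↔
    Refutes c.input (history c.G.go c.start (readNat (List ℕ × List ℕ) n).1)
      (readNat (List ℕ × List ℕ) n).1 (readNat (List ℕ × List ℕ) n).2 := by
  rw [c.G.indist_matrixDarts c.start]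
  rfl

/-- Evidence of one of the two kinds exists and can be recognized, so an unbounded search finds
some; no bound on the length of separating walks is needed. -/
theorem exists_computable_decision : ∃ f : List (List ℕ) × ℕ × ℕ × List Bool → Bool,
    Computable f ∧ ∀ c : Config, f c.code = true ↔ c ∈ quotientProblem := by
  classical
  obtain ⟨g, hg, hp⟩ := exists_computable_search
    -- The implication makes the search total: data that describe nothing are satisfied by any
    -- number.
    (p := fun x n => IsDescription x → RefutedBy x n ∨ ConfirmedBy x n)
    (primrecPred_imp (primrecPred_isDescription.comp Primrec.fst)
      (primrecPred_refutedBy.or primrecPred_confirmedBy)) (by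
      intro x
      by_cases hx : IsDescription x
      · obtain ⟨M, s, i, q⟩ := x
        obtain ⟨h1, h2, h3⟩ := hx
        obtain ⟨H, hH⟩ := isGraphCode_iff.1 h3
        simp only at h1 h2 hH
        subst hH
        obtain ⟨G, rfl⟩ : ∃ G : PortGraph, G.matrix = M := ⟨_, PortGraph.matrix_ofMatrix h1⟩
        rw [G.length_matrix] at h2
        by_cases hiso : G.quotient.IsIsomorphic H.toMultigraph
        · obtain ⟨σ, c, c', h⟩ := exists_confirms hiso
          refine ⟨Encodable.encode (σ, c, c'), fun _ => .inr ?_⟩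
          rw [ConfirmedBy, readNat_encode]
          exact h
        · obtain ⟨σ, c, h⟩ := exists_refutes hiso ⟨s, h2⟩
          refine ⟨Encodable.encode (σ, c), fun _ => .inl ?_⟩
          rw [RefutedBy, readNat_encode]
          rw [G.indist_matrixDarts ⟨s, h2⟩] at h
          exact h
      · exact ⟨0, fun h => absurd h hx⟩)
  -- It suffices to test the number found for refutation: refuting evidence is sound, and if the
  -- test fails then the number confirms.
  refine ⟨fun x => decide (IsDescription x) && decide (RefutedBy x (g x)), ?_, ?_⟩
  · have h1 : Computable fun x => decide (IsDescription x) :=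
      primrecPred_isDescription.decide.to_comp
    have h2 : Computable fun y : (List (List ℕ) × ℕ × ℕ × List Bool) × ℕ =>
        decide (RefutedBy y.1 y.2) := primrecPred_refutedBy.decide.to_comp
    have h3 := h2.comp (Computable.pair Computable.id hg)
    exact Primrec.and.to_comp.comp h1 h3
  · intro c
    simp only [Bool.and_eq_true, decide_eq_true_eq]
    constructor
    · rintro ⟨⟨_, _, hq⟩, hr⟩
      obtain ⟨H, hH⟩ := isGraphCode_iff.1 hq
      change c.input = H.code at hH
      rw [mem_quotientProblem_iff hH]
      intro hiso
      rw [refutedBy_code, hH] at hr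
      exact not_refutes hiso _ _ _ hr
    · intro hc
      obtain ⟨H, hH, hiso⟩ := hc
      have hd : IsDescription c.code := by
        refine ⟨c.G.isPortMatrix_matrix, ?_, isGraphCode_iff.2 ⟨H, hH⟩⟩
        change c.start.val < c.G.matrix.length
        rw [c.G.length_matrix]
        exact c.start.2
      refine ⟨hd, (hp c.code hd).resolve_right fun h => hiso ?_⟩
      have h' : Confirms c.G.matrix c.input _ _ _ := h
      rw [hH] at h'
      exact h'.isIsomorphic.1

/-! ### Invariance under renaming the nodes -/

theorem PortGraph.Iso.indist {G G' : PortGraph} (φ : PortGraph.Iso G G') (u : Fin G.size) :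
    Indist G.go G'.go u (φ.toEquiv u) := by
  have hadj : ∀ u v, G'.graph.Adj (φ.toEquiv u) (φ.toEquiv v) ↔ G.graph.Adj u v := fun u v => by
    rw [← port_ne_zero_iff, ← port_ne_zero_iff, φ.port_eq]
  refine indist_of_bisim (fun u v => φ.toEquiv u = v) ?_ rfl
  rintro u _ p rfl
  cases h : (G.go u p).2 with
  | some q =>
    obtain ⟨h1, h2, h3⟩ := adj_of_go h
    have := go_of_adj ((hadj _ _).2 h1)
    rw [φ.port_eq, φ.port_eq, h2, h3] at this
    rw [this]
    simp
  | none =>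
    cases h' : (G'.go (φ.toEquiv u) p).2 with
    | some q =>
      obtain ⟨h1, h2, h3⟩ := adj_of_go h'
      obtain ⟨w, hw⟩ := φ.toEquiv.surjective (G'.go (φ.toEquiv u) p).1
      rw [← hw] at h1 h2
      rw [hadj] at h1
      rw [φ.port_eq] at h2
      rw [← h2, go_of_adj h1] at h
      simp at h
    | none =>
      rw [reversible_go.stay _ _ h, reversible_go.stay _ _ h']
      simp

theorem quotientProblem_mem_delta1 : quotientProblem ∈ Delta1 := by
  refine ⟨exists_computable_decision, ?_⟩
  rintro c c' ⟨φ, hs, -, hin⟩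
  refine exists_congr fun H => ?_
  rw [hin, isIsomorphic_iff c.start, isIsomorphic_iff c'.start]
  have hi : Indist c.G.go c'.G.go c.start c'.start := hs ▸ φ.indist c.start
  have : (∃ h, Indist c.G.go (dartStep H.darts) c.start h) ↔
      ∃ h, Indist c'.G.go (dartStep H.darts) c'.start h :=
    exists_congr fun h => ⟨fun k => hi.symm.trans k, fun k => hi.trans k⟩
  rw [this]

/-! ### Protocols that end with a walk -/

theorem primrec_move {Q : Type} [Primcodable Q] : Primrec (Action.move : ℕ → Action Q) :=
  Primrec.of_equiv_symm (e := Action.equivSum Q) |>.comp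
    (Primrec.sumInl.comp Primrec.option_some)

theorem primrec_query {Q : Type} [Primcodable Q] : Primrec (Action.query : Q → Action Q) :=
  Primrec.of_equiv_symm (e := Action.equivSum Q) |>.comp (Primrec.sumInr.comp Primrec.sumInl)

theorem primrec_answer {Q : Type} [Primcodable Q] : Primrec (Action.answer : Bool → Action Q) :=
  Primrec.of_equiv_symm (e := Action.equivSum Q) |>.comp (Primrec.sumInr.comp Primrec.sumInr)

/-- Record the last entry port and go on along the planned walk; at its end answer according to the
recorded history and the other data in the memory. -/
def walkStep {A : Type} (Q : Type) (g : A → List (Option ℕ) → Bool)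
    (m : List ℕ × List (Option ℕ) × A) (o : Percept) :
    (List ℕ × List (Option ℕ) × A) × Action Q :=
  match m.1.head? with
  | some p => ((m.1.tail, o.1 :: m.2.1, m.2.2), .move p)
  | none => (m, .answer (g m.2.2 (o.1 :: m.2.1)))

theorem computable_walkStep {A Q : Type} [Primcodable A] [Primcodable Q]
    {g : A → List (Option ℕ) → Bool} (hg : Computable₂ g) : Computable₂ (walkStep Q g) := by
  let X := (List ℕ × List (Option ℕ) × A) × Percept
  have hm : Primrec fun x : X => x.1 := Primrec.fst
  have hh : Primrec fun x : X => x.2.1 :: x.1.2.1 := Primrec.list_cons.comp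
    (Primrec.fst.comp Primrec.snd) (Primrec.fst.comp (Primrec.snd.comp hm))
  have ha : Primrec fun x : X => x.1.2.2 := Primrec.snd.comp (Primrec.snd.comp hm)
  refine (Computable.option_casesOn (o := fun x : X => x.1.1.head?)
    (f := fun x => (x.1, (Action.answer (g x.1.2.2 (x.2.1 :: x.1.2.1)) : Action Q)))
    (g := fun x p => ((x.1.1.tail, x.2.1 :: x.1.2.1, x.1.2.2), (Action.move p : Action Q)))
    (Primrec.list_head?.comp (Primrec.fst.comp hm)).to_comp
    (Computable.pair hm.to_comp (primrec_answer.to_comp.comp (hg.comp ha.to_comp hh.to_comp)))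
    (Primrec.to_comp (Primrec.pair (Primrec.pair
      (Primrec.list_tail.comp (Primrec.fst.comp (hm.comp Primrec.fst)))
      (Primrec.pair (hh.comp Primrec.fst) (ha.comp Primrec.fst)))
      (primrec_move.comp Primrec.snd)))).of_eq ?_
  rintro ⟨m, o⟩
  simp only [walkStep]
  cases m.1.head? <;> rfl

/-! ### Runs of protocols -/

namespace Protocol

variable {I Q : Type} [Primcodable I] [Primcodable Q] {P : Protocol I Q} {G : PortGraph}
  {O : Set Q}

theorem next_stay {v : Fin G.size} {m m' : P.Mem} {o : Percept} (h : P.step m o = (m', .stay)) :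
    P.next G O (.running v m o) = .running v m' (none, G.degree v, none) := by
  simp only [next, h]

theorem next_move {v : Fin G.size} {m m' : P.Mem} {o : Percept} {p : ℕ}
    (h : P.step m o = (m', .move p)) : P.next G O (.running v m o) =
      .running (G.go v p).1 m' ((G.go v p).2, G.degree (G.go v p).1, none) := by
  simp only [next, h, PortGraph.go]
  cases G.follow v p <;> rfl

theorem next_answer {v : Fin G.size} {m m' : P.Mem} {o : Percept} {b : Bool}
    (h : P.step m o = (m', .answer b)) : P.next G O (.running v m o) = .decided b := by
  simp only [next, h]

theorem next_query_of_mem {v : Fin G.size} {m m' : P.Mem} {o : Percept} {q : Q}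
    (h : P.step m o = (m', .query q)) (hq : q ∈ O) : P.next G O (.running v m o) =
      .running v m' (none, G.degree v, some true) := by
  simp only [next, h, hq, decide_true]

theorem next_query_of_notMem {v : Fin G.size} {m m' : P.Mem} {o : Percept} {q : Q}
    (h : P.step m o = (m', .query q)) (hq : q ∉ O) : P.next G O (.running v m o) =
      .running v m' (none, G.degree v, some false) := by
  simp only [next, h, hq, decide_false]

/-- An agent whose memory evolves as in `walkStep` answers according to the history of its walk. -/
theorem exists_iterate_walk {A : Type} {g : A → List (Option ℕ) → Bool}
    (ι : List ℕ × List (Option ℕ) × A → P.Mem)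
    (hι : ∀ m o, P.step (ι m) o = (ι (walkStep Q g m o).1, (walkStep Q g m o).2))
    (v : Fin G.size) (σ : List ℕ) (h : List (Option ℕ)) (a : A) (o : Percept) :
    ∃ t, (P.next G O)^[t] (.running v (ι (σ, h, a)) o) =
      .decided (g a (history G.go v σ ++ o.1 :: h)) := by
  induction σ generalizing v h o with
  | nil => exact ⟨1, next_answer (hι _ _)⟩
  | cons p σ ih =>
    obtain ⟨t, ht⟩ := ih (G.go v p).1 (o.1 :: h) ((G.go v p).2, G.degree (G.go v p).1, none)
    refine ⟨t + 1, ?_⟩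
    rw [Function.iterate_succ_apply, next_move (hι _ _), history_cons]
    rw [List.append_assoc]
    exact ht

theorem iterate_decided (t : ℕ) (b : Bool) :
    (P.next G O)^[t] (.decided b) = .decided b :=
  Function.iterate_fixed rfl t

theorem Decides.unique {s : Fin G.size} {a : I} {b b' : Bool} (h : P.Decides G O s a b)
    (h' : P.Decides G O s a b') : b = b' := by
  obtain ⟨t, ht⟩ := h
  obtain ⟨t', ht'⟩ := h'
  have h1 := congrArg (P.next G O)^[t'] ht
  have h2 := congrArg (P.next G O)^[t] ht'
  rw [← Function.iterate_add_apply, iterate_decided] at h1 h2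
  rw [add_comm, h2] at h1
  simpa using h1.symm

/-- The runs proceed in lockstep: equal memories choose equal actions, the positions stay
indistinguishable, and therefore entry ports, degrees and the answers of the common black box
coincide. -/
theorem Decides.of_indist {G' : PortGraph} {s : Fin G.size} {s' : Fin G'.size} {a : I} {b : Bool}
    (hs : Indist G.go G'.go s s') (h : P.Decides G O s a b) : P.Decides G' O s' a b := by
  obtain ⟨t, ht⟩ := h
  refine ⟨t, ?_⟩
  rw [PortGraph.degree_eq_of_indist hs] at ht
  revert ht
  generalize P.init a = m
  generalize (none, G'.degree s', none) = o
  induction t generalizing s s' m o with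
  | zero => simp
  | succ t ih =>
    rw [Function.iterate_succ_apply, Function.iterate_succ_apply]
    obtain ⟨⟨m', act⟩, hstep⟩ : ∃ r, P.step m o = r := ⟨_, rfl⟩
    cases act with
    | stay =>
      rw [next_stay hstep, next_stay hstep, PortGraph.degree_eq_of_indist hs]
      exact ih hs _ _
    | move p =>
      rw [next_move hstep, next_move hstep, PortGraph.degree_eq_of_indist (hs.next p),
        hs.entry_eq p]
      exact ih (hs.next p) _ _
    | query q =>
      by_cases hq : q ∈ O
      · rw [next_query_of_mem hstep hq, next_query_of_mem hstep hq,
          PortGraph.degree_eq_of_indist hs]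
        exact ih hs _ _
      · rw [next_query_of_notMem hstep hq, next_query_of_notMem hstep hq,
          PortGraph.degree_eq_of_indist hs]
        exact ih hs _ _
    | answer b' =>
      rw [next_answer hstep, next_answer hstep, iterate_decided, iterate_decided]
      simp

end Protocol

/-- A certificate that leads to "yes" from `c` leads to the same decision from `c'`, where every
certificate would have to lead to "no" if `c'` were outside the problem. -/
theorem mem_of_indist {P : Protocol (ℕ × List Bool × List Bool) Empty} {Pb : Set Config}
    (hP : Verifies P Pb) {c c' : Config} (hid : c.ident = c'.ident) (hin : c.input = c'.input)
    (hs : Indist c.G.go c'.G.go c.start c'.start) (hc : c ∈ Pb) : c' ∈ Pb := by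
  by_contra hc'
  obtain ⟨x, hx⟩ := (hP c).2.1 hc
  have h := (hP c').2.2 hc' x
  have h' := hx.of_indist hs
  rw [hid, hin] at h'
  exact absurd (h'.unique h) (by simp)

/-! ### The problem `quotient` is verifiable -/

/-- Verify a certificate that encodes a walk and a coloring; the history of the walk ends with the
first perception, at which the agent has not moved yet. -/
def checkEvidence (a : List Bool × List ℕ × List ℕ) (h : List (Option ℕ)) : Prop :=
  IsGraphCode a.1 ∧ Refutes a.1 h.reverse.tail.reverse a.2.1 a.2.2

theorem primrecPred_checkEvidence :
    PrimrecPred fun x : (List Bool × List ℕ × List ℕ) × List (Option ℕ) =>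
      checkEvidence x.1 x.2 := by
  let X := (List Bool × List ℕ × List ℕ) × List (Option ℕ)
  have hq : Primrec fun x : X => x.1.1 := Primrec.fst.comp Primrec.fst
  have hh : Primrec fun x : X => x.2.reverse.tail.reverse :=
    Primrec.list_reverse.comp (Primrec.list_tail.comp (Primrec.list_reverse.comp Primrec.snd))
  have hw : Primrec fun x : X => x.1.2 := Primrec.snd.comp Primrec.fst
  have := (primrecPred_isGraphCode.comp hq).and
    (primrecPred_refutes.comp (Primrec.pair hq (Primrec.pair hh hw)))
  exact this

open Classical in
/-- The agent makes the walk that is encoded by the certificate. -/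
noncomputable def quotientVerifier : Protocol (ℕ × List Bool × List Bool) Empty where
  Mem := List ℕ × List (Option ℕ) × (List Bool × List ℕ × List ℕ)
  primcodableMem := inferInstance
  init x := ((readNat (List ℕ × List ℕ) (bitsValue x.2.2)).1, [], x.2.1,
    readNat (List ℕ × List ℕ) (bitsValue x.2.2))
  step := walkStep Empty fun a h => decide (checkEvidence a h)
  computable_init := by
    have h1 : Primrec fun x : ℕ × List Bool × List Bool =>
        readNat (List ℕ × List ℕ) (bitsValue x.2.2) :=
      primrec_readNat.comp (primrec_bitsValue.comp (Primrec.snd.comp Primrec.snd))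
    exact (Primrec.pair (Primrec.fst.comp h1) (Primrec.pair (Primrec.const [])
      (Primrec.pair (Primrec.fst.comp Primrec.snd) h1))).to_comp
  computable_step := computable_walkStep primrecPred_checkEvidence.decide.to_comp

open Classical in
theorem quotientVerifier_decides (c : Config) (x : List Bool) :
    quotientVerifier.Decides c.G ∅ c.start (c.ident, c.input, x)
      (decide (IsGraphCode c.input ∧ Refutes c.input
        (history c.G.go c.start (readNat (List ℕ × List ℕ) (bitsValue x)).1)
        (readNat (List ℕ × List ℕ) (bitsValue x)).1
        (readNat (List ℕ × List ℕ) (bitsValue x)).2)) := by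
  obtain ⟨t, ht⟩ := Protocol.exists_iterate_walk (P := quotientVerifier) (G := c.G) (O := ∅)
    (g := fun a h => decide (checkEvidence a h)) id (fun m o => rfl) c.start
    (readNat (List ℕ × List ℕ) (bitsValue x)).1 []
    (c.input, readNat (List ℕ × List ℕ) (bitsValue x)) (none, c.G.degree c.start, none)
  refine ⟨t, ht.trans ?_⟩
  simp [checkEvidence]

/-- Every certificate, meaningful or not, decodes to some finite walk, so the agent always decides;
soundness and completeness are those of `Refutes`. -/
theorem quotientProblem_mem_mav1 : quotientProblem ∈ MAV1 := by
  classical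
  refine ⟨quotientProblem_mem_delta1, quotientVerifier, fun c => ⟨?_, ?_, ?_⟩⟩
  · exact fun x => ⟨_, quotientVerifier_decides c x⟩
  · rintro ⟨H, hH, hiso⟩
    obtain ⟨σ, col, h⟩ := exists_refutes hiso c.start
    refine ⟨(Encodable.encode (σ, col)).bits, ?_⟩
    have := quotientVerifier_decides c (Encodable.encode (σ, col)).bits
    rw [bitsValue_bits, readNat_encode] at this
    rwa [decide_eq_true] at this
    refine ⟨isGraphCode_iff.2 ⟨H, hH⟩, ?_⟩
    rw [hH]
    exact h
  · intro hc x
    have := quotientVerifier_decides c x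
    rwa [decide_eq_false] at this
    rintro ⟨hq, hr⟩
    obtain ⟨H, hH⟩ := isGraphCode_iff.1 hq
    rw [mem_quotientProblem_iff hH, not_not] at hc
    rw [hH] at hr
    exact not_refutes hc _ _ _ hr

/-! ### Every verifiable problem is reducible to `quotient` -/

/-- The list of the edges of `G`, both ways, after the renaming `f` of the nodes. -/
noncomputable def PortGraph.imageEdges (G : PortGraph) {k : ℕ} (f : Fin G.size → Fin k) :
    List ((Fin k × ℕ) × (Fin k × ℕ)) :=
  (((Set.toFinite {e : Fin G.size × Fin G.size | G.graph.Adj e.1 e.2}).toFinset.toList).map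
    fun e => ((f e.1, G.port e.1 e.2), (f e.2, G.port e.2 e.1)))

theorem PortGraph.mem_imageEdges {G : PortGraph} {k : ℕ} {f : Fin G.size → Fin k} {x p y q} :
    ((x, p), (y, q)) ∈ G.imageEdges f ↔
      ∃ u v, G.graph.Adj u v ∧ f u = x ∧ f v = y ∧ G.port u v = p ∧ G.port v u = q := by
  simp only [imageEdges, List.mem_map, Finset.mem_toList, Set.Finite.mem_toFinset,
    Set.mem_ofPred_eq, Prod.exists, Prod.mk.injEq]
  constructor
  · rintro ⟨u, v, h, ⟨rfl, rfl⟩, rfl, rfl⟩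
    exact ⟨u, v, h, rfl, rfl, rfl, rfl⟩
  · rintro ⟨u, v, h, rfl, rfl, rfl, rfl⟩
    exact ⟨u, v, h, ⟨rfl, rfl⟩, rfl, rfl⟩

theorem PortGraph.connected_imageEdges {G : PortGraph} {k : ℕ} {f : Fin G.size → Fin k}
    (hf : Function.Surjective f) : (PortMultigraph.ofList (G.imageEdges f)).Connected := by
  obtain ⟨s⟩ := G.connected.nonempty
  have : Nonempty (Fin k) := ⟨f s⟩
  refine SimpleGraph.Connected.mk fun x y => ?_
  obtain ⟨u, rfl⟩ := hf x
  obtain ⟨v, rfl⟩ := hf y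
  obtain ⟨w⟩ := G.connected.preconnected u v
  induction w with
  | nil => exact .refl _
  | @cons a b _ ha _ ih =>
    refine SimpleGraph.Reachable.trans ?_ ih
    by_cases he : f a = f b
    · rw [he]
    · refine SimpleGraph.Adj.reachable ?_
      rw [SimpleGraph.fromRel_adj]
      exact ⟨he, .inl ⟨G.port a b, G.port b a, _, mem_imageEdges.2 ⟨a, b, ha, rfl, rfl, rfl, rfl⟩,
        rfl⟩⟩

/-- Guarantees that the enumeration of guesses in the reduction meets a description of the true
quotient graph. -/
theorem exists_givenGraph (G : PortGraph) :
    ∃ H : GivenGraph, G.quotient.IsIsomorphic H.toMultigraph := by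
  obtain ⟨k, ⟨e⟩⟩ := Finite.exists_equiv_fin (Quotient G.viewSetoid)
  let f : Fin G.size → Fin k := fun u => e (Quotient.mk _ u)
  have hf : Function.Surjective f := e.surjective.comp Quotient.mk_surjective
  let H : GivenGraph := ⟨k, G.imageEdges f, by
    rintro ⟨⟨x, p⟩, ⟨y, q⟩⟩ hd
    obtain ⟨u, v, ha, -, -, rfl, rfl⟩ := PortGraph.mem_imageEdges.1 hd
    exact ⟨Nat.pos_of_ne_zero (PortGraph.port_ne_zero ha),
      Nat.pos_of_ne_zero (PortGraph.port_ne_zero ha.symm)⟩,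
    PortGraph.connected_imageEdges hf⟩
  refine ⟨H, isIsomorphic_iff_exists_isQuotientMap.2 ⟨f, hf, ?_, ?_⟩⟩
  · intro u v
    simp only [f, e.apply_eq_iff_eq, Quotient.eq]
    exact PortGraph.viewSetoid_iff
  · intro x p y q
    -- The list already contains each edge in both directions, so `bothWays` adds no new dart.
    change _ ∈ bothWays (G.imageEdges f) ↔ _
    simp only [bothWays, List.mem_append, List.mem_map]
    constructor
    · rintro (h | ⟨⟨⟨y', q'⟩, ⟨x', p'⟩⟩, h, he⟩)
      · exact PortGraph.mem_imageEdges.1 h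
      · simp only [Prod.swap_prod_mk, Prod.mk.injEq] at he
        obtain ⟨⟨rfl, rfl⟩, rfl, rfl⟩ := he
        obtain ⟨u, v, ha, h1, h2, h3, h4⟩ := PortGraph.mem_imageEdges.1 h
        exact ⟨v, u, ha.symm, h2, h1, h4, h3⟩
    · exact fun h => .inl (PortGraph.mem_imageEdges.2 h)

/-- What the agent guesses: the matrix of a graph, the description of its quotient graph, and the
evidence for this, beginning with a walk. -/
abbrev Guess : Type := List (List ℕ) × List Bool × List ℕ × List ℕ × List ℕ

/-- The guess is correct apart from the question whether the quotient graph is the one of the graph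
in which the agent operates. -/
def IsConsistent (x : Guess) : Prop :=
  IsPortMatrix x.1 ∧ IsGraphCode x.2.1 ∧ Confirms x.1 x.2.1 x.2.2.1 x.2.2.2.1 x.2.2.2.2

theorem primrecPred_isConsistent : PrimrecPred IsConsistent := by
  have h1 := primrecPred_isPortMatrix.comp (Primrec.fst (α := List (List ℕ))
    (β := List Bool × List ℕ × List ℕ × List ℕ))
  have h2 := primrecPred_isGraphCode.comp (Primrec.fst.comp (Primrec.snd (α := List (List ℕ))
    (β := List Bool × List ℕ × List ℕ × List ℕ)))
  have := h1.and (h2.and primrecPred_confirms)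
  exact this

/-- A node of the guessed graph from which the walk in the guess yields the recorded history; the
history ends with a perception at the start, where the agent has not moved yet. -/
def locate (x : Guess) (h : List (Option ℕ)) : ℕ :=
  (List.range x.1.length).findIdx fun u =>
    decide (history (dartStep (matrixDarts x.1)) u x.2.2.1 = h.reverse.tail.reverse)

theorem primrec_locate : Primrec₂ locate := by
  let X := Guess × List (Option ℕ)
  have hM : Primrec fun x : X => x.1.1 := Primrec.fst.comp Primrec.fst
  have hσ : Primrec fun x : X => x.1.2.2.1 :=
    Primrec.fst.comp (Primrec.snd.comp (Primrec.snd.comp Primrec.fst))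
  have h1 : Primrec fun y : X × ℕ =>
      history (dartStep (matrixDarts y.1.1.1)) y.2 y.1.1.2.2.1 :=
    primrec_history.comp (Primrec.pair (primrec_matrixDarts.comp (hM.comp Primrec.fst))
      (Primrec.pair Primrec.snd (hσ.comp Primrec.fst)))
  have h2 : Primrec fun y : X × ℕ => y.1.2.reverse.tail.reverse :=
    Primrec.list_reverse.comp (Primrec.list_tail.comp (Primrec.list_reverse.comp
      (Primrec.snd.comp Primrec.fst)))
  have h3 := (primrecPred_eq h1 h2).decide
  have := Primrec.list_findIdx (Primrec.list_range.comp (Primrec.list_length.comp hM)) h3.to₂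
  exact this

/-! ### The search protocol -/

section Reduction

variable (f : List (List ℕ) × ℕ × ℕ × List Bool → Bool)

/-- Decide the guessed configuration; `a` consists of the identity, the input and the number of the
guess. -/
def decideGuess (a : (ℕ × List Bool) × ℕ) (h : List (Option ℕ)) : Bool :=
  f ((readNat Guess a.2).1, locate (readNat Guess a.2) h, a.1)

theorem computable_decideGuess (hf : Computable f) : Computable₂ (decideGuess f) := by
  let X := ((ℕ × List Bool) × ℕ) × List (Option ℕ)
  have h1 : Primrec fun x : X => readNat Guess x.1.2 :=
    primrec_readNat.comp (Primrec.snd.comp Primrec.fst)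
  have h2 : Primrec fun x : X => locate (readNat Guess x.1.2) x.2 :=
    primrec_locate.comp h1 Primrec.snd
  have h3 : Primrec fun x : X => ((readNat Guess x.1.2).1, locate (readNat Guess x.1.2) x.2, x.1.1) :=
    Primrec.pair (Primrec.fst.comp h1) (Primrec.pair h2 (Primrec.fst.comp Primrec.fst))
  exact hf.comp h3.to_comp

/-- The memory of an agent that tries one guess after the other, and then makes a walk. -/
abbrev SearchMem : Type :=
  ((ℕ × List Bool) × ℕ) ⊕ (List ℕ × List (Option ℕ) × ((ℕ × List Bool) × ℕ))

open Classical in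
/-- Submit the next guess to the black box if it is consistent.  If the black box has just answered
"no", start the walk of the last guess. -/
noncomputable def searchStep (a : (ℕ × List Bool) × ℕ) (o : Percept) :
    SearchMem × Action (List Bool) :=
  if o.2.2 = some false then
    -- The counter was advanced when the query was submitted, so the guess just answered has the
    -- previous number.
    (.inr ((readNat Guess (a.2 - 1)).2.2.1, [], a.1, a.2 - 1), .stay)
  else if IsConsistent (readNat Guess a.2) then
    (.inl (a.1, a.2 + 1), .query (readNat Guess a.2).2.1)
  else (.inl (a.1, a.2 + 1), .stay)

theorem searchStep_walk {a : ℕ × List Bool} {n : ℕ} {o : Percept} (ho : o.2.2 = some false) :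
    searchStep (a, n + 1) o = (.inr ((readNat Guess n).2.2.1, [], a, n), .stay) := by
  simp [searchStep, ho]

theorem searchStep_query {a : ℕ × List Bool} {n : ℕ} {o : Percept} (ho : o.2.2 ≠ some false)
    (hn : IsConsistent (readNat Guess n)) :
    searchStep (a, n) o = (.inl (a, n + 1), .query (readNat Guess n).2.1) := by
  simp [searchStep, ho, hn]

theorem searchStep_skip {a : ℕ × List Bool} {n : ℕ} {o : Percept} (ho : o.2.2 ≠ some false)
    (hn : ¬ IsConsistent (readNat Guess n)) :
    searchStep (a, n) o = (.inl (a, n + 1), .stay) := by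
  simp [searchStep, ho, hn]

theorem computable_searchStep : Computable₂ searchStep := by
  classical
  refine Primrec.to_comp ?_
  let X := ((ℕ × List Bool) × ℕ) × Percept
  have ha : Primrec fun x : X => x.1.1 := Primrec.fst.comp Primrec.fst
  have hn : Primrec fun x : X => x.1.2 := Primrec.snd.comp Primrec.fst
  have hpred : Primrec fun x : X => x.1.2 - 1 := Primrec.nat_sub.comp hn (Primrec.const 1)
  have hsucc : Primrec fun x : X => x.1.2 + 1 := Primrec.succ.comp hn
  have hg : Primrec fun x : X => readNat Guess x.1.2 := primrec_readNat.comp hn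
  have hg' : Primrec fun x : X => readNat Guess (x.1.2 - 1) := primrec_readNat.comp hpred
  have hcons : PrimrecPred fun x : X => IsConsistent (readNat Guess x.1.2) :=
    primrecPred_isConsistent.comp hg
  have h1 : Primrec fun x : X => ((.inr ((readNat Guess (x.1.2 - 1)).2.2.1, [], x.1.1, x.1.2 - 1),
      .stay) : SearchMem × Action (List Bool)) :=
    Primrec.pair (Primrec.sumInr.comp (Primrec.pair
      (Primrec.fst.comp (Primrec.snd.comp (Primrec.snd.comp hg')))
      (Primrec.pair (Primrec.const []) (Primrec.pair ha hpred)))) (Primrec.const _)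
  have h2 : Primrec fun x : X => ((.inl (x.1.1, x.1.2 + 1),
      .query (readNat Guess x.1.2).2.1) : SearchMem × Action (List Bool)) :=
    Primrec.pair (Primrec.sumInl.comp (Primrec.pair ha hsucc))
      (primrec_query.comp (Primrec.fst.comp (Primrec.snd.comp hg)))
  have h3 : Primrec fun x : X => ((.inl (x.1.1, x.1.2 + 1), .stay) :
      SearchMem × Action (List Bool)) :=
    Primrec.pair (Primrec.sumInl.comp (Primrec.pair ha hsucc)) (Primrec.const _)
  have h4 : PrimrecPred fun x : X => x.2.2.2 = some false :=
    primrecPred_eq (Primrec.snd.comp (Primrec.snd.comp Primrec.snd)) (Primrec.const _)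
  have := Primrec.ite h4 h1 (Primrec.ite hcons h2 h3)
  exact this

/-- The protocol that finds the quotient graph with the help of the black box, locates the agent in
some graph with this quotient graph, and applies `f` there. -/
noncomputable def reduction (hf : Computable f) : Protocol (ℕ × List Bool) (List Bool) where
  Mem := SearchMem
  primcodableMem := inferInstance
  init a := .inl (a, 0)
  step m o := Sum.elim (fun a => searchStep a o)
    (fun m => (.inr (walkStep (List Bool) (decideGuess f) m o).1,
      (walkStep (List Bool) (decideGuess f) m o).2)) m
  computable_init := Computable.sumInl.comp (Computable.pair Computable.id (Computable.const 0))
  computable_step := by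
    have hw : Computable₂ fun (x : SearchMem × Percept)
        (m : List ℕ × List (Option ℕ) × ((ℕ × List Bool) × ℕ)) =>
        walkStep (List Bool) (decideGuess f) m x.2 :=
      (computable_walkStep (computable_decideGuess f hf)).comp Computable.snd
        (Computable.snd.comp Computable.fst)
    have hs : Computable₂ fun (x : SearchMem × Percept) (a : (ℕ × List Bool) × ℕ) =>
        searchStep a x.2 :=
      computable_searchStep.comp Computable.snd (Computable.snd.comp Computable.fst)
    have hw' : Computable₂ fun (x : SearchMem × Percept)
        (m : List ℕ × List (Option ℕ) × ((ℕ × List Bool) × ℕ)) =>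
        (((.inr (walkStep (List Bool) (decideGuess f) m x.2).1,
          (walkStep (List Bool) (decideGuess f) m x.2).2)) : SearchMem × Action (List Bool)) :=
      Computable.pair (Computable.sumInr.comp (Computable.fst.comp hw)) (Computable.snd.comp hw)
    have := Computable.sumCasesOn (Computable.fst (α := SearchMem) (β := Percept)) hs hw'
    refine this.of_eq ?_
    rintro ⟨_ | _, _⟩ <;> rfl

variable {f}

/-- The guess with the number `n` is the first that passes the test of the black box. -/
theorem reduction_decides (hf : Computable f) {G : PortGraph} {O : Set (List Bool)}
    {s : Fin G.size} {a : ℕ × List Bool} {n : ℕ} (hn : IsConsistent (readNat Guess n))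
    (hnO : (readNat Guess n).2.1 ∉ O)
    (hmin : ∀ k < n, IsConsistent (readNat Guess k) → (readNat Guess k).2.1 ∈ O) :
    (reduction f hf).Decides G O s a
      (decideGuess f (a, n) (history G.go s (readNat Guess n).2.2.1 ++ [none])) := by
  -- Each unsuccessful guess costs exactly one round, so after `k` rounds the counter is `k`, the
  -- agent is still at `s`, and no "no" has been heard.
  have key : ∀ k ≤ n, ∃ b : Option Bool, b ≠ some false ∧ ((reduction f hf).next G O)^[k]
      (.running s ((reduction f hf).init a) (none, G.degree s, none)) =
      .running s (Sum.inl (a, k)) (none, G.degree s, b) := by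
    intro k
    induction k with
    | zero => exact fun _ => ⟨none, by simp, rfl⟩
    | succ k ih =>
      intro hk
      obtain ⟨b, hb, he⟩ := ih (by omega)
      rw [Function.iterate_succ_apply', he]
      by_cases hc : IsConsistent (readNat Guess k)
      · refine ⟨some true, by simp, Protocol.next_query_of_mem (P := reduction f hf)
          (searchStep_query hb hc) (hmin k (by omega) hc)⟩
      · refine ⟨none, by simp, Protocol.next_stay (P := reduction f hf) (searchStep_skip hb hc)⟩
  obtain ⟨b, hb, he⟩ := key n le_rfl
  have h1 : (reduction f hf).next G O (.running s (Sum.inl (a, n)) (none, G.degree s, b)) =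
      .running s (Sum.inl (a, n + 1)) (none, G.degree s, some false) :=
    Protocol.next_query_of_notMem (P := reduction f hf) (searchStep_query hb hn) hnO
  have h2 : (reduction f hf).next G O
      (.running s (Sum.inl (a, n + 1)) (none, G.degree s, some false)) =
      .running s (Sum.inr ((readNat Guess n).2.2.1, [], a, n)) (none, G.degree s, none) :=
    Protocol.next_stay (P := reduction f hf)
      (searchStep_walk (a := a) (n := n) (o := (none, G.degree s, some false)) rfl)
  obtain ⟨t, ht⟩ := Protocol.exists_iterate_walk (P := reduction f hf) (G := G) (O := O)
    (g := decideGuess f) Sum.inr (fun m o => rfl) s (readNat Guess n).2.2.1 [] (a, n)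
    (none, G.degree s, none)
  -- There are `n` rounds for the failed guesses, one for the successful query, one in which its
  -- answer is read and the walk is set up, and `t` for the walk and the decision.
  refine ⟨t + 1 + 1 + n, ?_⟩
  rw [Function.iterate_add_apply, he, Function.iterate_succ_apply, h1,
    Function.iterate_succ_apply, h2]
  exact ht

end Reduction

/-- In another graph with the same quotient graph, the walk that distinguishes the nodes of the
quotient graph locates a node with the same view. -/
theorem locate_spec {G G' : PortGraph} {H : GivenGraph} {σ c c' : List ℕ}
    (hiso : G.quotient.IsIsomorphic H.toMultigraph) (hconf : Confirms G'.matrix H.code σ c c')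
    (s : Fin G.size) : ∃ s' : Fin G'.size, Indist G.go G'.go s s' ∧
      locate (G'.matrix, H.code, σ, c, c') (history G.go s σ ++ [none]) = s' := by
  obtain ⟨hiso', hσ⟩ := hconf.isIsomorphic
  obtain ⟨g, hg⟩ := isIsomorphic_iff_exists_isQuotientMap.1 hiso
  obtain ⟨g', hg'⟩ := isIsomorphic_iff_exists_isQuotientMap.1 hiso'
  -- The node that `locate` finds need not be the `u` chosen below, but any node with the right
  -- history lies over the same node of `H`, because `σ` separates the nodes of `H`.
  have heq : ∀ u : Fin G'.size, history (dartStep (matrixDarts G'.matrix)) u σ =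
      history G.go s σ → Indist G.go G'.go s u := by
    intro u hu
    have : g' u = g s := by
      apply hσ
      rw [← hg'.indist u σ, ← hg.indist s σ, G'.indist_matrixDarts u σ, hu]
    exact (hg.indist s).trans (this ▸ (hg'.indist u).symm)
  -- Some node of `G'` lies over the same node of `H` as `s`, so the search for a matching history
  -- succeeds.
  obtain ⟨u, hu⟩ := hg'.surjective (g s)
  have hu' : history (dartStep (matrixDarts G'.matrix)) u σ = history G.go s σ := by
    rw [← G'.indist_matrixDarts u σ, hg'.indist u σ, hu, hg.indist s σ]
  have hlt : locate (G'.matrix, H.code, σ, c, c') (history G.go s σ ++ [none]) < G'.size := by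
    have : locate (G'.matrix, H.code, σ, c, c') (history G.go s σ ++ [none]) <
        (List.range G'.matrix.length).length := by
      refine List.findIdx_lt_length_of_exists ⟨u.val, ?_, ?_⟩
      · rw [List.mem_range, G'.length_matrix]
        exact u.2
      · simpa using hu'
    rwa [List.length_range, G'.length_matrix] at this
  refine ⟨⟨_, hlt⟩, heq _ ?_, rfl⟩
  have hlt' : locate (G'.matrix, H.code, σ, c, c') (history G.go s σ ++ [none]) <
        (List.range G'.matrix.length).length := by
    rwa [List.length_range, G'.length_matrix]
  have := List.findIdx_getElem (w := hlt')
  simpa [locate] using this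

/-- The guessed graph may differ from the one in which the agent operates. It only has to share its
quotient, for then it contains a start with the same view, and verifiability forces the same answer
there. -/
theorem reducible_quotientProblem {Pb : Set Config} (hPb : Pb ∈ MAV1) :
    Reducible Pb quotientProblem := by
  obtain ⟨⟨⟨f, hf, hfc⟩, -⟩, P, hP⟩ := hPb
  refine ⟨reduction f hf, fun c => ?_⟩
  suffices h : ∃ c', (c ∈ Pb ↔ c' ∈ Pb) ∧ (reduction f hf).Decides c.G
      {q | { c with input := q } ∈ quotientProblem} c.start (c.ident, c.input) (f c'.code) by
    obtain ⟨c', hc', hd⟩ := h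
    constructor
    · intro hc
      rwa [(hfc c').2 (hc'.1 hc)] at hd
    · intro hc
      have : f c'.code = false := by
        rw [Bool.eq_false_iff]
        exact fun h => hc (hc'.2 ((hfc c').1 h))
      rwa [this] at hd
  set O : Set (List Bool) := {q | { c with input := q } ∈ quotientProblem} with hO
  -- A "no" is informative only for codes of graphs, since other strings are outside the problem
  -- too; this is why only consistent guesses are submitted.
  have hOmem : ∀ H : GivenGraph, H.code ∉ O ↔ c.G.quotient.IsIsomorphic H.toMultigraph := by
    intro H
    have := mem_quotientProblem_iff (c := { c with input := H.code }) (H := H) rfl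
    rw [hO, Set.mem_ofPred_eq, this, not_not]
  have hex : ∃ n, IsConsistent (readNat Guess n) ∧ (readNat Guess n).2.1 ∉ O := by
    obtain ⟨H, hH⟩ := exists_givenGraph c.G
    obtain ⟨σ, col, col', h⟩ := exists_confirms hH
    -- The guess made from the true graph is a successful one, so the enumeration stops, possibly
    -- earlier with another graph.
    refine ⟨Encodable.encode (c.G.matrix, H.code, σ, col, col'), ?_⟩
    rw [readNat_encode]
    exact ⟨⟨c.G.isPortMatrix_matrix, isGraphCode_iff.2 ⟨H, rfl⟩, h⟩, (hOmem H).2 hH⟩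
  classical
  obtain ⟨hn, hnO⟩ := Nat.find_spec hex
  have hmin : ∀ k < Nat.find hex, IsConsistent (readNat Guess k) → (readNat Guess k).2.1 ∈ O :=
    fun k hk hc => by_contra fun h => Nat.find_min hex hk ⟨hc, h⟩
  have hd := reduction_decides hf (G := c.G) (s := c.start) (a := (c.ident, c.input)) hn hnO hmin
  generalize Nat.find hex = n at hn hnO hd
  unfold decideGuess at hd
  simp only at hd
  obtain ⟨⟨M, q, σ, col, col'⟩, hg⟩ : ∃ x, readNat Guess n = x := ⟨_, rfl⟩
  rw [hg] at hn hnO hd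
  obtain ⟨hM, hq, hconf⟩ := hn
  simp only at hM hq hconf hnO hd
  obtain ⟨H, rfl⟩ := isGraphCode_iff.1 hq
  obtain ⟨G', rfl⟩ : ∃ G : PortGraph, G.matrix = M := ⟨_, PortGraph.matrix_ofMatrix hM⟩
  obtain ⟨s', hs', hloc⟩ := locate_spec ((hOmem H).1 hnO) hconf c.start
  rw [hloc] at hd
  refine ⟨⟨G', s', c.ident, c.ident_pos, c.input⟩, ?_, hd⟩
  exact ⟨mem_of_indist hP rfl rfl hs', mem_of_indist hP rfl rfl hs'.symm⟩

end MobileAgents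

theorem mainTheorem3 :
    MobileAgents.IsComplete MobileAgents.MAV1 MobileAgents.quotientProblem :=
  ⟨MobileAgents.quotientProblem_mem_mav1, fun _ h => MobileAgents.reducible_quotientProblem h⟩
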